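/- Let $\mathcal C$ be a small monoidal category with tensor unit $I$. A central idempotent of $\mathcal C$ is a morphism $u\colon U\to I$ together with a half-braiding $\sigma_A\colon U\otimes A\cong A\otimes U$ ($A\in\mathcal C$) such that $(A\otimes u)\circ\sigma_A=u\otimes A$ for all $A$, $u\otimes U=U\otimes u\colon U\otimes U\to U$ (up to unitors), and this morphism is invertible. Two central idempotents $u,v$ are identified when $u=v\circ m$ for an isomorphism $m\colon U\to V$ that respects the half-braidings. The resulting set $ZI(\mathcal C)$ is partially ordered by $u\le v$ iff $u=v\circ m$ for some $m\colon U\to V$ that respects the half-braidings; it has top element $1=\mathrm{id}_I$ and meets $u\wedge v=u\otimes v$. The category $\mathcal C$ has universal finite joins of central idempotents when it has an initial object $0$ with $A\otimes 0\cong 0\cong 0\otimes A$ for all $A$, and any two central idempotents $u,v$ have a join $u\vee v$ in $ZI(\mathcal C)$ such that for every object $A$ the square $$\begin{array}{ccc}A\otimes U\otimes V&\to&A\otimes V\\ \downarrow&&\downarrow\\ A\otimes U&\to&A\otimes(U\vee V)\end{array}$$ is both a pullback and a pushout. A monoidal category $\mathcal D$ is $\vee$-local when $ZI(\mathcal D)$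 has at least two elements and $p\vee q=1$ in $ZI(\mathcal D)$ only if $p=1$ or $q=1$. For a filter $x\subseteq ZI(\mathcal C)$, the stalk $\mathcal C|_x$ is the following monoidal category. Its objects are those of $\mathcal C$. A morphism $A\to B$ is a class $[v,f]$ with $v\in x$ and $f\colon A\otimes V\to B$ in $\mathcal C$, where $[v,f]=[v',f']$ if $f$ and $f'$ agree after restriction along $U\to V$ and $U\to V'$ for some $u\in x$ with $u\le v\wedge v'$. Composition is $[v,g]\circ[u,f]=[u\wedge v,\,g\circ(f\otimes V)]$, and identities are $[1,\mathrm{id}]$. The tensor product is that of $\mathcal C$ on objects, and on morphisms is $[u,f]\otimes[v,g]=[u\wedge v,\,f\otimes g]$, precomposed with the half-braiding of $U$. **Corollary.** Let $\mathcal C$ be a small monoidal category with universal finite joins of central idempotents. 1. The tuple $\mathcal C\to\prod_x\mathcal C|_x$ of the quotient functors $A\mapsto A$, $f\mapsto[1,f]$, where $x$ ranges over the prime filters of $ZI(\mathcal C)$, is a strong monoidal faithful functor. It is injective on objects as soon as $ZI(\mathcal C)$ has at least two elements. 2. If $\mathcal C$ is braided, then each of the stalks $\mathcal C|_x$ at a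 prime filter $x$ is $\vee$-local. 3. In general, braided or not, $\mathcal C$ embeds monoidally into a product of $\vee$-local monoidal categories: there are a family $(\mathcal D_i)_{i}$ of small $\vee$-local monoidal categories and a strong monoidal functor $\mathcal C\to\prod_i\mathcal D_i$ that is faithful and injective on objects. -/

import Mathlib

open CategoryTheory MonoidalCategory

universe v u

section CentralIdempotents

variable (C : Type u) [Category.{v} C] [MonoidalCategory C]

/-- A central idempotent of `C`, as a representative: a morphism `hom : obj ⟶ 𝟙_ C` whose domain
carries a half-braiding that makes `hom` a morphism of the centre, such that
`hom ⊗ obj = obj ⊗ hom : obj ⊗ obj ⟶ obj` (up to unitors), this morphism being invertible. -/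
structure CentralIdempotent where
  obj : C
  hom : obj ⟶ 𝟙_ C
  braid : HalfBraiding obj
  hom_braid : ∀ A : C, (braid.β A).hom ≫ A ◁ hom ≫ (ρ_ A).hom = hom ▷ A ≫ (λ_ A).hom
  central : hom ▷ obj ≫ (λ_ obj).hom = obj ◁ hom ≫ (ρ_ obj).hom
  isIso_left : IsIso (hom ▷ obj ≫ (λ_ obj).hom)

end CentralIdempotents

namespace CentralIdempotent

variable {C : Type u} [Category.{v} C] [MonoidalCategory C]

attribute [instance] CentralIdempotent.isIso_left

/-- Morphisms `u ⟶ v` of central idempotents: morphisms of the domains over the unit that respect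
the half-braidings. -/
@[ext]
structure Hom (u v : CentralIdempotent C) where
  hom : u.obj ⟶ v.obj
  fac : hom ≫ v.hom = u.hom
  comm : ∀ A : C, hom ▷ A ≫ (v.braid.β A).hom = (u.braid.β A).hom ≫ A ◁ hom

/-- `u` and `v` represent the same central idempotent when there is an isomorphism of their domains
over the unit that respects the half-braidings. -/
def Equivalent (u v : CentralIdempotent C) : Prop := ∃ m : Hom u v, IsIso m.hom

lemma isIso_whiskerRight (u : CentralIdempotent C) : IsIso (u.hom ▷ u.obj) := by
  have := u.isIso_left
  exact IsIso.of_isIso_comp_right _ (λ_ u.obj).hom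

/-- Morphisms of central idempotents are unique. -/
lemma fac_unique {u v : CentralIdempotent C} (m n : u.obj ⟶ v.obj)
    (hm : m ≫ v.hom = u.hom) (hn : n ≫ v.hom = u.hom) : m = n := by
  have h1 : (m ⊗ₘ n) ≫ v.hom ▷ v.obj ≫ (λ_ v.obj).hom = (u.hom ▷ u.obj ≫ (λ_ u.obj).hom) ≫ n := by
    rw [tensorHom_def', Category.assoc, ← comp_whiskerRight_assoc, hm, whisker_exchange_assoc,
      leftUnitor_naturality, Category.assoc]
  have h2 : (m ⊗ₘ n) ≫ v.obj ◁ v.hom ≫ (ρ_ v.obj).hom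
      = (u.obj ◁ u.hom ≫ (ρ_ u.obj).hom) ≫ m := by
    rw [MonoidalCategory.tensorHom_def, Category.assoc, ← whiskerLeft_comp_assoc, hn, ← whisker_exchange_assoc,
      rightUnitor_naturality, Category.assoc]
  rw [← v.central, h1, ← u.central] at h2
  exact ((cancel_epi _).1 h2).symm

lemma isIso_hom_whiskerRight_tensor (v : CentralIdempotent C) (A : C) :
    IsIso (v.hom ▷ (A ⊗ v.obj)) := by
  have := v.isIso_whiskerRight
  have h : v.hom ▷ (A ⊗ v.obj) = (α_ _ _ _).inv ≫ ((v.braid.β A).hom ▷ v.obj) ≫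
      (α_ _ _ _).hom ≫ A ◁ (v.hom ▷ v.obj ≫ (λ_ _).hom) ≫ (λ_ (A ⊗ v.obj)).inv := by
    have := v.hom_braid A
    rw [← cancel_mono (λ_ (A ⊗ v.obj)).hom]
    calc _ = 𝟙 _ ⊗≫ (v.hom ▷ A ≫ (λ_ A).hom) ▷ v.obj ⊗≫ 𝟙 _ := by monoidal
      _ = _ := by rw [← this]; monoidal
  rw [h]; infer_instance

lemma isIso_whiskerLeft_whiskerLeft_hom (v : CentralIdempotent C) (A : C) :
    IsIso (v.obj ◁ A ◁ v.hom) := by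
  have := v.isIso_whiskerRight
  have h := v.braid.naturality (A ◁ v.hom)
  rw [← Iso.eq_comp_inv] at h
  rw [h, whisker_assoc]; infer_instance

/-- A morphism over the unit automatically respects the half-braidings. -/
def Hom.ofFac {u v : CentralIdempotent C} (m : u.obj ⟶ v.obj) (hm : m ≫ v.hom = u.hom) :
    Hom u v where
  hom := m
  fac := hm
  comm A := by
    have h0 : (m ▷ A ≫ (v.braid.β A).hom) ≫ A ◁ v.hom
        = ((u.braid.β A).hom ≫ A ◁ m) ≫ A ◁ v.hom := by
      rw [← cancel_mono (ρ_ A).hom]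
      simp only [Category.assoc, v.hom_braid, ← whiskerLeft_comp_assoc, hm, u.hom_braid,
        ← comp_whiskerRight_assoc]
    have h1 : v.obj ◁ (m ▷ A ≫ (v.braid.β A).hom) = v.obj ◁ ((u.braid.β A).hom ≫ A ◁ m) := by
      have := v.isIso_whiskerLeft_whiskerLeft_hom A
      rw [← cancel_mono (v.obj ◁ A ◁ v.hom), ← whiskerLeft_comp, h0, whiskerLeft_comp]
    have h2 : IsIso (u.hom ▷ (u.obj ⊗ A)) := by
      have := u.isIso_whiskerRight
      rw [whiskerRight_tensor]; infer_instance
    have h3 : v.hom ▷ (u.obj ⊗ A) ≫ 𝟙_ C ◁ (m ▷ A ≫ (v.braid.β A).hom)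
        = v.hom ▷ (u.obj ⊗ A) ≫ 𝟙_ C ◁ ((u.braid.β A).hom ≫ A ◁ m) := by
      rw [← whisker_exchange, h1, whisker_exchange]
    have h4 : u.hom ▷ (u.obj ⊗ A) ≫ 𝟙_ C ◁ (m ▷ A ≫ (v.braid.β A).hom)
        = u.hom ▷ (u.obj ⊗ A) ≫ 𝟙_ C ◁ ((u.braid.β A).hom ≫ A ◁ m) := by
      rw [← hm, comp_whiskerRight, Category.assoc, h3, Category.assoc]
    have h5 := (cancel_epi _).1 h4
    rwa [id_whiskerLeft, id_whiskerLeft, cancel_epi, cancel_mono] at h5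

def Hom.id (u : CentralIdempotent C) : Hom u u := .ofFac (𝟙 _) (by simp)

def Hom.comp {u v w : CentralIdempotent C} (m : Hom u v) (n : Hom v w) : Hom u w :=
  .ofFac (m.hom ≫ n.hom) (by rw [Category.assoc, n.fac, m.fac])

lemma isIso_of_hom_hom {u v : CentralIdempotent C} (m : Hom u v) (n : Hom v u) : IsIso m.hom :=
  ⟨n.hom, fac_unique _ _ (by rw [Category.assoc, n.fac, m.fac]) (by simp),
    fac_unique _ _ (by rw [Category.assoc, m.fac, n.fac]) (by simp)⟩

lemma equivalent_iff {u v : CentralIdempotent C} :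
    Equivalent u v ↔ Nonempty (Hom u v) ∧ Nonempty (Hom v u) := by
  constructor
  · rintro ⟨m, hm⟩
    exact ⟨⟨m⟩, ⟨.ofFac (inv m.hom) (by rw [← m.fac, IsIso.inv_hom_id_assoc])⟩⟩
  · rintro ⟨⟨m⟩, ⟨n⟩⟩
    exact ⟨m, isIso_of_hom_hom m n⟩

variable (C) in
def setoid : Setoid (CentralIdempotent C) where
  r := Equivalent
  iseqv :=
    { refl := fun u => equivalent_iff.2 ⟨⟨.id u⟩, ⟨.id u⟩⟩
      symm := fun h => equivalent_iff.2 (equivalent_iff.1 h).symm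
      trans := fun h k => by
        obtain ⟨⟨a⟩, ⟨b⟩⟩ := equivalent_iff.1 h
        obtain ⟨⟨c⟩, ⟨d⟩⟩ := equivalent_iff.1 k
        exact equivalent_iff.2 ⟨⟨a.comp c⟩, ⟨d.comp b⟩⟩ }

lemma braid_unit (v : CentralIdempotent C) :
    (v.braid.β (𝟙_ C)).hom = (ρ_ v.obj).hom ≫ (λ_ v.obj).inv := by
  have h1 := v.braid.monoidal (𝟙_ C) (𝟙_ C)
  have h2 := v.braid.naturality (λ_ (𝟙_ C)).hom
  obtain ⟨c, hc⟩ : ∃ c : v.obj ≅ v.obj,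
      (v.braid.β (𝟙_ C)).hom = (ρ_ v.obj).hom ≫ c.hom ≫ (λ_ v.obj).inv :=
    ⟨(ρ_ _).symm ≪≫ v.braid.β (𝟙_ C) ≪≫ λ_ _, by simp⟩
  rw [h1, hc] at h2
  have h3 : c.hom = c.hom ≫ c.hom := by
    calc c.hom = 𝟙 _ ⊗≫ (v.obj ◁ (λ_ (𝟙_ C)).hom ≫ (ρ_ v.obj).hom ≫ c.hom ≫ (λ_ v.obj).inv) ⊗≫
          𝟙 _ := by monoidal
      _ = _ := by rw [h2]; monoidal
  have h4 : c.hom = 𝟙 _ := by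
    have h5 : c.hom ≫ 𝟙 _ = c.hom ≫ c.hom := by rw [Category.comp_id]; exact h3
    exact ((cancel_epi _).1 h5).symm
  rw [hc, h4, Category.id_comp]

lemma hom_braid' (v : CentralIdempotent C) {A : C} (a : A ⟶ 𝟙_ C) :
    (v.braid.β A).hom ≫ a ▷ v.obj ≫ (λ_ v.obj).hom = v.obj ◁ a ≫ (ρ_ v.obj).hom := by
  rw [← v.braid.naturality_assoc, braid_unit, Category.assoc, Iso.inv_hom_id, Category.comp_id]

/-- The unit, as a central idempotent. -/
abbrev unit : CentralIdempotent C where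
  obj := 𝟙_ C
  hom := 𝟙 _
  braid := Center.tensorUnit.2
  hom_braid A := by simp [Center.tensorUnit]
  central := by simp [unitors_equal]
  isIso_left := by infer_instance

/-- The meet of central idempotents is their tensor product. -/
abbrev tensor (u v : CentralIdempotent C) : CentralIdempotent C where
  obj := u.obj ⊗ v.obj
  hom := (u.hom ⊗ₘ v.hom) ≫ (λ_ (𝟙_ C)).hom
  braid := (Center.tensorObj ⟨u.obj, u.braid⟩ ⟨v.obj, v.braid⟩).2
  hom_braid A := by
    simp only [Center.tensorObj, Iso.trans_hom, whiskerLeftIso_hom, Iso.symm_hom, whiskerRightIso_hom]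
    have hu := u.hom_braid A
    have hv := v.hom_braid A
    calc _ = 𝟙 _ ⊗≫ u.obj ◁ (v.braid.β A).hom ⊗≫ (u.braid.β A).hom ▷ v.obj ⊗≫
          A ◁ (u.hom ⊗ₘ v.hom) ⊗≫ 𝟙 _ := by monoidal
      _ = 𝟙 _ ⊗≫ u.obj ◁ (v.braid.β A).hom ⊗≫ ((u.braid.β A).hom ≫ A ◁ u.hom ≫ (ρ_ A).hom) ▷ v.obj ⊗≫
          A ◁ v.hom ⊗≫ 𝟙 _ := by rw [MonoidalCategory.tensorHom_def]; monoidal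
      _ = 𝟙 _ ⊗≫ u.obj ◁ (v.braid.β A).hom ⊗≫ (u.hom ▷ (A ⊗ v.obj) ≫ 𝟙_ C ◁ (A ◁ v.hom)) ⊗≫ 𝟙 _ := by
        rw [hu]; monoidal
      _ = 𝟙 _ ⊗≫ u.obj ◁ ((v.braid.β A).hom ≫ A ◁ v.hom ≫ (ρ_ A).hom) ⊗≫ u.hom ▷ A ⊗≫ 𝟙 _ := by
        rw [← whisker_exchange]; monoidal
      _ = 𝟙 _ ⊗≫ (u.obj ◁ v.hom ≫ u.hom ▷ _) ▷ A ⊗≫ 𝟙 _ := by rw [hv]; monoidal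
      _ = _ := by rw [← tensorHom_def']; monoidal
  central := by
    have hb := v.hom_braid u.obj
    calc _ = 𝟙 _ ⊗≫ u.obj ◁ (v.hom ▷ u.obj ≫ (λ_ _).hom) ▷ v.obj ⊗≫
          (u.hom ▷ u.obj) ▷ v.obj ⊗≫ 𝟙 _ := by rw [tensorHom_def']; monoidal
      _ = 𝟙 _ ⊗≫ u.obj ◁ (v.braid.β u.obj).hom ▷ v.obj ⊗≫
          (u.obj ⊗ u.obj) ◁ (v.hom ▷ v.obj ≫ (λ_ _).hom) ⊗≫
          (u.hom ▷ u.obj ≫ (λ_ _).hom) ▷ v.obj ⊗≫ 𝟙 _ := by rw [← hb]; monoidal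
      _ = 𝟙 _ ⊗≫ u.obj ◁ ((v.braid.β u.obj).hom ▷ v.obj ≫ (u.obj ⊗ v.obj) ◁ v.hom) ⊗≫
          u.obj ◁ u.hom ▷ v.obj ⊗≫ 𝟙 _ := by rw [u.central, v.central]; monoidal
      _ = 𝟙 _ ⊗≫ u.obj ◁ ((v.obj ⊗ u.obj) ◁ v.hom) ⊗≫
          u.obj ◁ ((v.braid.β u.obj).hom ≫ u.hom ▷ v.obj ≫ (λ_ _).hom) ⊗≫ 𝟙 _ := by
        rw [← whisker_exchange]; monoidal
      _ = _ := by rw [hom_braid', tensorHom_def']; monoidal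
  isIso_left := by
    have h : ((u.hom ⊗ₘ v.hom) ≫ (λ_ (𝟙_ C)).hom) ▷ (u.obj ⊗ v.obj) ≫ (λ_ (u.obj ⊗ v.obj)).hom
        = (α_ _ _ _).hom ≫ u.obj ◁ (v.hom ▷ (u.obj ⊗ v.obj) ≫ (λ_ _).hom) ≫
          (α_ _ _ _).inv ≫ (u.hom ▷ u.obj ≫ (λ_ _).hom) ▷ v.obj := by
      rw [tensorHom_def']; monoidal
    have := v.isIso_hom_whiskerRight_tensor u.obj
    rw [h]; infer_instance


def tensorFst (u v : CentralIdempotent C) : Hom (u.tensor v) u :=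
  .ofFac (u.obj ◁ v.hom ≫ (ρ_ _).hom) (by
    change (u.obj ◁ v.hom ≫ (ρ_ u.obj).hom) ≫ u.hom = (u.hom ⊗ₘ v.hom) ≫ (λ_ (𝟙_ C)).hom
    rw [tensorHom_def', Category.assoc, Category.assoc, unitors_equal, rightUnitor_naturality])

def tensorSnd (u v : CentralIdempotent C) : Hom (u.tensor v) v :=
  .ofFac (u.hom ▷ v.obj ≫ (λ_ _).hom) (by
    change (u.hom ▷ v.obj ≫ (λ_ v.obj).hom) ≫ v.hom = (u.hom ⊗ₘ v.hom) ≫ (λ_ (𝟙_ C)).hom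
    rw [MonoidalCategory.tensorHom_def, Category.assoc, Category.assoc, leftUnitor_naturality])

def Hom.tensor {u u' v v' : CentralIdempotent C} (m : Hom u u') (n : Hom v v') :
    Hom (u.tensor v) (u'.tensor v') :=
  .ofFac (m.hom ⊗ₘ n.hom) (by
    change (m.hom ⊗ₘ n.hom) ≫ (u'.hom ⊗ₘ v'.hom) ≫ (λ_ (𝟙_ C)).hom
      = (u.hom ⊗ₘ v.hom) ≫ (λ_ (𝟙_ C)).hom
    rw [tensorHom_comp_tensorHom_assoc, m.fac, n.fac])

noncomputable def Hom.lift {w u v : CentralIdempotent C} (m : Hom w u) (n : Hom w v) :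
    Hom w (u.tensor v) :=
  .ofFac (inv (w.hom ▷ w.obj ≫ (λ_ w.obj).hom) ≫ (m.hom ⊗ₘ n.hom)) (by
    change _ ≫ (u.hom ⊗ₘ v.hom) ≫ (λ_ (𝟙_ C)).hom = w.hom
    rw [Category.assoc, tensorHom_comp_tensorHom_assoc, m.fac, n.fac, IsIso.inv_comp_eq,
      MonoidalCategory.tensorHom_def, Category.assoc, Category.assoc, leftUnitor_naturality])

def toUnit (u : CentralIdempotent C) : Hom u unit := .ofFac u.hom (Category.comp_id _)

end CentralIdempotent

section ZI

variable (C : Type u) [Category.{v} C] [MonoidalCategory C]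

/-- The set `ZI(C)` of central idempotents of `C`. -/
def ZI : Type (max u v) := Quotient (CentralIdempotent.setoid C)

variable {C}

/-- The central idempotent represented by `u`. -/
def CentralIdempotent.toZI (u : CentralIdempotent C) : ZI C := Quotient.mk _ u

open CentralIdempotent

/-- `u ≤ v` when `u` factors through `v` via a morphism that respects the half-braidings. -/
instance : LE (ZI C) where
  le := Quotient.lift₂ (fun u v => Nonempty (Hom u v)) (by
    intro a b a' b' h k
    obtain ⟨⟨h1⟩, ⟨h2⟩⟩ := equivalent_iff.1 h
    obtain ⟨⟨k1⟩, ⟨k2⟩⟩ := equivalent_iff.1 k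
    exact propext ⟨fun ⟨m⟩ => ⟨(h2.comp m).comp k1⟩, fun ⟨m⟩ => ⟨(h1.comp m).comp k2⟩⟩)

lemma toZI_le_toZI {u v : CentralIdempotent C} : u.toZI ≤ v.toZI ↔ Nonempty (Hom u v) := Iff.rfl

instance : PartialOrder (ZI C) where
  le_refl := by rintro ⟨u⟩; exact ⟨.id u⟩
  le_trans := by rintro ⟨u⟩ ⟨v⟩ ⟨w⟩ ⟨m⟩ ⟨n⟩; exact ⟨m.comp n⟩
  le_antisymm := by rintro ⟨u⟩ ⟨v⟩ h k; exact Quotient.sound (equivalent_iff.2 ⟨h, k⟩)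

instance : OrderTop (ZI C) where
  top := unit.toZI
  le_top := by rintro ⟨u⟩; exact ⟨u.toUnit⟩

lemma CentralIdempotent.unit_mem (x : Order.PFilter (ZI C)) : (unit : CentralIdempotent C).toZI ∈ x :=
  Order.PFilter.top_mem

lemma CentralIdempotent.tensor_mem {x : Order.PFilter (ZI C)} {u v : CentralIdempotent C}
    (hu : u.toZI ∈ x) (hv : v.toZI ∈ x) : (u.tensor v).toZI ∈ x := by
  obtain ⟨w, hw, h1, h2⟩ := x.directed _ hu _ hv
  refine Order.PFilter.mem_of_le ?_ hw
  induction w using Quotient.inductionOn with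
  | h w =>
    obtain ⟨m⟩ := h1
    obtain ⟨n⟩ := h2
    exact ⟨m.lift n⟩

end ZI

section Stalk

variable {C : Type u} [Category.{v} C] [MonoidalCategory C]

open CentralIdempotent

/-- A representative of a morphism `A ⟶ B` of the stalk at the filter `x`: a central idempotent in
`x` together with a morphism `A ⊗ idem ⟶ B` of `C`. -/
structure Germ (x : Order.PFilter (ZI C)) (A B : C) where
  idem : CentralIdempotent C
  mem : idem.toZI ∈ x
  map : A ⊗ idem.obj ⟶ B

/-- Two representatives are identified when they agree on some central idempotent in `x` that lies
below both. -/
def Germ.Rel {x : Order.PFilter (ZI C)} {A B : C} (r s : Germ x A B) : Prop :=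
  ∃ (w : CentralIdempotent C) (_ : w.toZI ∈ x) (m : Hom w r.idem) (n : Hom w s.idem),
    A ◁ m.hom ≫ r.map = A ◁ n.hom ≫ s.map

def Germ.setoid (x : Order.PFilter (ZI C)) (A B : C) : Setoid (Germ x A B) where
  r := Germ.Rel
  iseqv :=
    { refl := fun r => ⟨r.idem, r.mem, .id _, .id _, rfl⟩
      symm := fun ⟨w, hw, m, n, h⟩ => ⟨w, hw, n, m, h.symm⟩
      trans := by
        rintro r s t ⟨w, hw, m, n, h⟩ ⟨z, hz, k, l, h'⟩
        refine ⟨w.tensor z, tensor_mem hw hz, (w.tensorFst z).comp m, (w.tensorSnd z).comp l, ?_⟩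
        have e : (w.tensorFst z).hom ≫ n.hom = (w.tensorSnd z).hom ≫ k.hom :=
          fac_unique _ _ ((w.tensorFst z).comp n).fac ((w.tensorSnd z).comp k).fac
        change A ◁ ((w.tensorFst z).hom ≫ m.hom) ≫ _ = A ◁ ((w.tensorSnd z).hom ≫ l.hom) ≫ _
        rw [whiskerLeft_comp, whiskerLeft_comp, Category.assoc, Category.assoc, h, ← h',
          ← whiskerLeft_comp_assoc, ← whiskerLeft_comp_assoc, e] }

/-- The stalk of `C` at a filter `x` of central idempotents. Its objects are those of `C`. -/
structure Stalk (x : Order.PFilter (ZI C)) : Type u where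
  obj : C

namespace Stalk

variable {x : Order.PFilter (ZI C)}

/-- Morphisms of the stalk are germs of morphisms of `C`. -/
instance : Quiver (Stalk x) where
  Hom X Y := Quotient (Germ.setoid x X.obj Y.obj)

/-- The morphism `[v, f]` of the stalk. -/
def germ (v : CentralIdempotent C) (hv : v.toZI ∈ x) {X Y : Stalk x}
    (f : X.obj ⊗ v.obj ⟶ Y.obj) : X ⟶ Y :=
  Quotient.mk (Germ.setoid x X.obj Y.obj) ⟨v, hv, f⟩

lemma ind {X Y : Stalk x} {P : (X ⟶ Y) → Prop} (h : ∀ v hv f, P (germ v hv f)) (φ : X ⟶ Y) :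
    P φ :=
  Quotient.inductionOn φ fun r => h r.idem r.mem r.map

lemma germ_eq {X Y : Stalk x} {v w z : CentralIdempotent C} {hv : v.toZI ∈ x} {hw : w.toZI ∈ x}
    {f : X.obj ⊗ v.obj ⟶ Y.obj} {g : X.obj ⊗ w.obj ⟶ Y.obj} (hz : z.toZI ∈ x)
    (m : Hom z v) (n : Hom z w)
    (h : X.obj ◁ m.hom ≫ f = X.obj ◁ n.hom ≫ g) : germ v hv f = germ w hw g :=
  Quotient.sound ⟨z, hz, m, n, h⟩

lemma germ_res {X Y : Stalk x} {v z : CentralIdempotent C} {hv : v.toZI ∈ x}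
    (hz : z.toZI ∈ x) {f : X.obj ⊗ v.obj ⟶ Y.obj} (m : Hom z v) (f' : X.obj ⊗ z.obj ⟶ Y.obj)
    (h : X.obj ◁ m.hom ≫ f = f') : germ v hv f = germ z hz f' :=
  germ_eq hz m (.id z) (by rw [h]; change _ = X.obj ◁ (𝟙 _) ≫ _; simp)

/-- `[u, f] ≫ [v, g] = [u ∧ v, (f ⊗ v) ≫ g]`, and the identity is `[1, 𝟙]`. -/
instance : CategoryStruct (Stalk x) where
  id X := germ unit (unit_mem x) (ρ_ X.obj).hom
  comp {X Y Z} := Quotient.map₂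
    (fun r s => ⟨r.idem.tensor s.idem, tensor_mem r.mem s.mem,
      (α_ X.obj r.idem.obj s.idem.obj).inv ≫ r.map ▷ s.idem.obj ≫ s.map⟩)
    (by
      rintro r r' ⟨w, hw, m, n, h⟩ s s' ⟨z, hz, k, l, h'⟩
      refine ⟨w.tensor z, tensor_mem hw hz, m.tensor k, n.tensor l, ?_⟩
      change X.obj ◁ (m.hom ⊗ₘ k.hom) ≫ (α_ X.obj r.idem.obj s.idem.obj).inv ≫
        r.map ▷ s.idem.obj ≫ s.map = X.obj ◁ (n.hom ⊗ₘ l.hom) ≫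
        (α_ X.obj r'.idem.obj s'.idem.obj).inv ≫ r'.map ▷ s'.idem.obj ≫ s'.map
      have key : ∀ {a b : C} (m : w.obj ⟶ a) (k : z.obj ⟶ b) (f : X.obj ⊗ a ⟶ Y.obj)
          (g : Y.obj ⊗ b ⟶ Z.obj), X.obj ◁ (m ⊗ₘ k) ≫ (α_ X.obj a b).inv ≫ f ▷ b ≫ g =
            (α_ _ _ _).inv ≫ (X.obj ◁ m ≫ f) ▷ z.obj ≫ Y.obj ◁ k ≫ g := by
        intro a b m k f g
        calc _ = 𝟙 _ ⊗≫ X.obj ◁ m ▷ z.obj ⊗≫ ((X.obj ⊗ a) ◁ k ≫ f ▷ b) ≫ g := by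
              rw [MonoidalCategory.tensorHom_def]; monoidal
          _ = _ := by rw [whisker_exchange]; monoidal
      rw [key, key, h, h'])

lemma id_def (X : Stalk x) : 𝟙 X = germ unit (unit_mem x) (ρ_ X.obj).hom := rfl

lemma germ_comp_germ {X Y Z : Stalk x} {u v : CentralIdempotent C} {hu : u.toZI ∈ x}
    {hv : v.toZI ∈ x} (f : X.obj ⊗ u.obj ⟶ Y.obj) (g : Y.obj ⊗ v.obj ⟶ Z.obj) :
    germ u hu f ≫ germ v hv g = germ (u.tensor v) (tensor_mem hu hv)
      ((α_ X.obj u.obj v.obj).inv ≫ f ▷ v.obj ≫ g) := rfl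

instance : Category (Stalk x) where
  id_comp := by
    intro X Y φ
    induction φ using ind with | h v hv f =>
    rw [id_def, germ_comp_germ]
    refine (germ_res _ (unit.tensorSnd v) _ ?_).symm
    change X.obj ◁ (𝟙 (𝟙_ C) ▷ v.obj ≫ (λ_ v.obj).hom) ≫ f
      = (α_ X.obj (𝟙_ C) v.obj).inv ≫ (ρ_ X.obj).hom ▷ v.obj ≫ f
    simp
  comp_id := by
    intro X Y φ
    induction φ using ind with | h v hv f =>
    rw [id_def, germ_comp_germ]
    refine (germ_res _ (v.tensorFst unit) _ ?_).symm
    change X.obj ◁ (v.obj ◁ 𝟙 (𝟙_ C) ≫ (ρ_ v.obj).hom) ≫ f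
      = (α_ X.obj v.obj (𝟙_ C)).inv ≫ f ▷ 𝟙_ C ≫ (ρ_ Y.obj).hom
    simp
  assoc := by
    intro X Y Z W φ ψ χ
    induction φ using ind with | h u hu f =>
    induction ψ using ind with | h v hv g =>
    induction χ using ind with | h w hw k =>
    simp only [germ_comp_germ]
    refine (germ_res _ (.ofFac (α_ u.obj v.obj w.obj).hom ?_) _ ?_).symm
    · change (α_ u.obj v.obj w.obj).hom ≫
        (u.hom ⊗ₘ ((v.hom ⊗ₘ w.hom) ≫ (λ_ (𝟙_ C)).hom)) ≫ (λ_ (𝟙_ C)).hom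
        = (((u.hom ⊗ₘ v.hom) ≫ (λ_ (𝟙_ C)).hom) ⊗ₘ w.hom) ≫ (λ_ (𝟙_ C)).hom
      simp only [MonoidalCategory.tensorHom_def]
      monoidal
    · change X.obj ◁ (α_ u.obj v.obj w.obj).hom ≫ (α_ X.obj u.obj (v.obj ⊗ w.obj)).inv ≫
        f ▷ (v.obj ⊗ w.obj) ≫ (α_ Y.obj v.obj w.obj).inv ≫ g ▷ w.obj ≫ k =
        (α_ X.obj (u.obj ⊗ v.obj) w.obj).inv ≫
          ((α_ X.obj u.obj v.obj).inv ≫ f ▷ v.obj ≫ g) ▷ w.obj ≫ k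
      monoidal


variable (x) in
/-- The quotient functor from `C` to its stalk at `x`, `f ↦ [1, f]`. -/
abbrev toStalk : C ⥤ Stalk x where
  obj A := ⟨A⟩
  map {A B} f := germ (X := ⟨A⟩) (Y := ⟨B⟩) unit (unit_mem x) ((ρ_ A).hom ≫ f)
  map_id A := by rw [Category.comp_id]; rfl
  map_comp {A B D} f g := by
    rw [germ_comp_germ]
    refine germ_eq (tensor_mem (unit_mem x) (unit_mem x)) (unit.tensorFst unit) (.id _) ?_
    change A ◁ (𝟙_ C ◁ 𝟙 (𝟙_ C) ≫ (ρ_ _).hom) ≫ (ρ_ A).hom ≫ f ≫ g = A ◁ 𝟙 _ ≫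
      (α_ A (𝟙_ C) (𝟙_ C)).inv ≫ ((ρ_ A).hom ≫ f) ▷ 𝟙_ C ≫ (ρ_ B).hom ≫ g
    simp only [whiskerLeft_id, Category.id_comp]
    monoidal

/-- The morphism `A ⊗ v ⟶ A` of `C`; it becomes invertible in the stalks at filters that
contain `v`. -/
def counit (A : C) (v : CentralIdempotent C) : A ⊗ v.obj ⟶ A := A ◁ v.hom ≫ (ρ_ A).hom

lemma toStalk_counit_comp_germ {X Y : Stalk x} (v : CentralIdempotent C) (hv : v.toZI ∈ x)
    (f : X.obj ⊗ v.obj ⟶ Y.obj) :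
    (toStalk x).map (counit X.obj v) ≫ germ v hv f = (toStalk x).map f := by
  change germ (unit.tensor v) _ ((α_ (X.obj ⊗ v.obj) (𝟙_ C) v.obj).inv ≫
    ((ρ_ (X.obj ⊗ v.obj)).hom ≫ counit X.obj v) ▷ v.obj ≫ f) =
      germ unit _ ((ρ_ (X.obj ⊗ v.obj)).hom ≫ f)
  refine germ_eq (tensor_mem (unit_mem x) hv) (.id _) (tensorFst _ _) ?_
  change (X.obj ⊗ v.obj) ◁ (𝟙 _) ≫ _ =
    (X.obj ⊗ v.obj) ◁ (𝟙_ C ◁ v.hom ≫ (ρ_ (𝟙_ C)).hom) ≫ (ρ_ (X.obj ⊗ v.obj)).hom ≫ f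
  have h := v.central
  calc _ = 𝟙 _ ⊗≫ X.obj ◁ (v.hom ▷ v.obj ≫ (λ_ _).hom) ⊗≫ f := by
        rw [counit]; monoidal
    _ = _ := by rw [h]; monoidal

lemma germ_eq_germ_comp {X Y : Stalk x} (v : CentralIdempotent C) (hv : v.toZI ∈ x)
    (f : X.obj ⊗ v.obj ⟶ Y.obj) :
    germ v hv f = germ (Y := (toStalk x).obj (X.obj ⊗ v.obj)) v hv (𝟙 _) ≫ (toStalk x).map f := by
  symm
  change germ (v.tensor unit) _ ((α_ X.obj v.obj (𝟙_ C)).inv ≫ (𝟙 (X.obj ⊗ v.obj)) ▷ (𝟙_ C) ≫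
    (ρ_ (X.obj ⊗ v.obj)).hom ≫ f) = germ v hv f
  refine germ_eq (tensor_mem hv (unit_mem x)) (.id _) (tensorFst _ _) ?_
  change X.obj ◁ (𝟙 _) ≫ _ = X.obj ◁ (v.obj ◁ 𝟙 (𝟙_ C) ≫ (ρ_ v.obj).hom) ≫ f
  simp

lemma isIso_toStalk_counit (A : C) (v : CentralIdempotent C) (hv : v.toZI ∈ x) :
    IsIso ((toStalk x).map (counit A v)) := by
  refine ⟨germ (X := ⟨A⟩) (Y := ⟨A ⊗ v.obj⟩) v hv (𝟙 _), ?_, ?_⟩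
  · refine (toStalk_counit_comp_germ (X := ⟨A⟩) (Y := ⟨A ⊗ v.obj⟩) v hv (𝟙 _)).trans ?_
    exact (toStalk x).map_id _
  · refine (germ_eq_germ_comp (X := ⟨A⟩) (Y := ⟨A⟩) v hv (counit A v)).symm.trans ?_
    refine germ_eq hv (.id _) v.toUnit ?_
    change A ◁ (𝟙 _) ≫ A ◁ v.hom ≫ (ρ_ A).hom = A ◁ v.hom ≫ (ρ_ A).hom
    simp

/-- Every morphism of the stalk is a fraction of morphisms of `C`. -/
lemma exists_fraction {X Y : Stalk x} (φ : X ⟶ Y) :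
    ∃ (A : C) (e : A ⟶ X.obj) (f : A ⟶ Y.obj), IsIso ((toStalk x).map e) ∧
      (toStalk x).map e ≫ φ = (toStalk x).map f := by
  induction φ using ind with | h v hv f =>
  exact ⟨_, counit X.obj v, f, isIso_toStalk_counit _ v hv, toStalk_counit_comp_germ v hv f⟩

/-- `Z ◁ [v, f] = [v, Z ⊗ f]`. -/
def whiskerLeft (Z : Stalk x) {X Y : Stalk x} :
    (X ⟶ Y) → ((⟨Z.obj ⊗ X.obj⟩ : Stalk x) ⟶ ⟨Z.obj ⊗ Y.obj⟩) :=
  Quotient.map (fun r => ⟨r.idem, r.mem, (α_ Z.obj X.obj r.idem.obj).hom ≫ Z.obj ◁ r.map⟩) (by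
    rintro r s ⟨w, hw, m, n, h⟩
    refine ⟨w, hw, m, n, ?_⟩
    change (Z.obj ⊗ X.obj) ◁ m.hom ≫ (α_ Z.obj X.obj r.idem.obj).hom ≫ Z.obj ◁ r.map =
      (Z.obj ⊗ X.obj) ◁ n.hom ≫ (α_ Z.obj X.obj s.idem.obj).hom ≫ Z.obj ◁ s.map
    simp only [tensor_whiskerLeft, Category.assoc, Iso.inv_hom_id_assoc, ← whiskerLeft_comp, h])

/-- `[v, f] ▷ Z = [v, f ⊗ Z]`, where the half-braiding moves `v` past `Z`. -/
def whiskerRight {X Y : Stalk x} (φ : X ⟶ Y) (Z : Stalk x) :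
    (⟨X.obj ⊗ Z.obj⟩ : Stalk x) ⟶ ⟨Y.obj ⊗ Z.obj⟩ :=
  Quotient.map (fun r => ⟨r.idem, r.mem, (α_ X.obj Z.obj r.idem.obj).hom ≫
      X.obj ◁ (r.idem.braid.β Z.obj).inv ≫ (α_ X.obj r.idem.obj Z.obj).inv ≫ r.map ▷ Z.obj⟩) (by
    rintro r s ⟨w, hw, m, n, h⟩
    refine ⟨w, hw, m, n, ?_⟩
    change (X.obj ⊗ Z.obj) ◁ m.hom ≫ (α_ X.obj Z.obj r.idem.obj).hom ≫
      X.obj ◁ (r.idem.braid.β Z.obj).inv ≫ (α_ X.obj r.idem.obj Z.obj).inv ≫ r.map ▷ Z.obj =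
      (X.obj ⊗ Z.obj) ◁ n.hom ≫ (α_ X.obj Z.obj s.idem.obj).hom ≫
      X.obj ◁ (s.idem.braid.β Z.obj).inv ≫ (α_ X.obj s.idem.obj Z.obj).inv ≫ s.map ▷ Z.obj
    have key : ∀ {a : CentralIdempotent C} (m : Hom w a) (f : X.obj ⊗ a.obj ⟶ Y.obj),
        (X.obj ⊗ Z.obj) ◁ m.hom ≫ (α_ X.obj Z.obj a.obj).hom ≫
          X.obj ◁ (a.braid.β Z.obj).inv ≫ (α_ X.obj a.obj Z.obj).inv ≫ f ▷ Z.obj =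
        (α_ X.obj Z.obj w.obj).hom ≫
          X.obj ◁ (w.braid.β Z.obj).inv ≫ (α_ X.obj w.obj Z.obj).inv ≫
            (X.obj ◁ m.hom ≫ f) ▷ Z.obj := by
      intro a m f
      have hm : Z.obj ◁ m.hom ≫ (a.braid.β Z.obj).inv = (w.braid.β Z.obj).inv ≫ m.hom ▷ Z.obj := by
        rw [Iso.comp_inv_eq, Category.assoc, Iso.eq_inv_comp, m.comm]
      calc _ = 𝟙 _ ⊗≫ X.obj ◁ (Z.obj ◁ m.hom ≫ (a.braid.β Z.obj).inv) ⊗≫ f ▷ Z.obj := by monoidal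
        _ = _ := by rw [hm]; monoidal
    rw [key, key, h]) φ

lemma whiskerLeft_germ (Z : Stalk x) {X Y : Stalk x} (v : CentralIdempotent C) (hv : v.toZI ∈ x)
    (f : X.obj ⊗ v.obj ⟶ Y.obj) : whiskerLeft Z (germ v hv f) =
      germ v hv ((α_ Z.obj X.obj v.obj).hom ≫ Z.obj ◁ f) := rfl

lemma whiskerRight_germ (Z : Stalk x) {X Y : Stalk x} (v : CentralIdempotent C) (hv : v.toZI ∈ x)
    (f : X.obj ⊗ v.obj ⟶ Y.obj) : whiskerRight (germ v hv f) Z =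
      germ v hv ((α_ X.obj Z.obj v.obj).hom ≫ X.obj ◁ (v.braid.β Z.obj).inv ≫
        (α_ X.obj v.obj Z.obj).inv ≫ f ▷ Z.obj) := rfl

lemma whiskerLeft_map (Z : Stalk x) {A B : C} (f : A ⟶ B) :
    whiskerLeft Z ((toStalk x).map f) = (toStalk x).map (Z.obj ◁ f) := by
  change germ unit _ ((α_ Z.obj A (𝟙_ C)).hom ≫ Z.obj ◁ ((ρ_ A).hom ≫ f)) =
    germ unit _ ((ρ_ (Z.obj ⊗ A)).hom ≫ Z.obj ◁ f)
  congr 1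
  monoidal

lemma whiskerRight_map (Z : Stalk x) {A B : C} (f : A ⟶ B) :
    whiskerRight ((toStalk x).map f) Z = (toStalk x).map (f ▷ Z.obj) := by
  change germ unit _ ((α_ A Z.obj (𝟙_ C)).hom ≫ A ◁ ((ρ_ Z.obj).hom ≫ (λ_ Z.obj).inv) ≫
    (α_ A (𝟙_ C) Z.obj).inv ≫ ((ρ_ A).hom ≫ f) ▷ Z.obj) =
    germ unit _ ((ρ_ (A ⊗ Z.obj)).hom ≫ f ▷ Z.obj)
  congr 1
  monoidal

lemma whiskerLeft_comp (Z : Stalk x) {X Y W : Stalk x} (φ : X ⟶ Y) (ψ : Y ⟶ W) :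
    whiskerLeft Z (φ ≫ ψ) = whiskerLeft Z φ ≫ whiskerLeft Z ψ := by
  induction φ using ind with | h u hu f =>
  induction ψ using ind with | h v hv g =>
  simp only [germ_comp_germ, whiskerLeft_germ]
  congr 1
  monoidal

lemma whiskerRight_comp (Z : Stalk x) {X Y W : Stalk x} (φ : X ⟶ Y) (ψ : Y ⟶ W) :
    whiskerRight (φ ≫ ψ) Z = whiskerRight φ Z ≫ whiskerRight ψ Z := by
  induction φ using ind with | h u hu f =>
  induction ψ using ind with | h v hv g =>
  change germ (u.tensor v) _ ((α_ X.obj Z.obj (u.obj ⊗ v.obj)).hom ≫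
    X.obj ◁ ((α_ u.obj v.obj Z.obj) ≪≫ whiskerLeftIso u.obj (v.braid.β Z.obj) ≪≫
      (α_ u.obj Z.obj v.obj).symm ≪≫ whiskerRightIso (u.braid.β Z.obj) v.obj ≪≫
        α_ Z.obj u.obj v.obj).inv ≫ (α_ X.obj (u.obj ⊗ v.obj) Z.obj).inv ≫
    ((α_ X.obj u.obj v.obj).inv ≫ f ▷ v.obj ≫ g) ▷ Z.obj) =
    germ (u.tensor v) _ ((α_ (X.obj ⊗ Z.obj) u.obj v.obj).inv ≫
      ((α_ X.obj Z.obj u.obj).hom ≫ X.obj ◁ (u.braid.β Z.obj).inv ≫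
        (α_ X.obj u.obj Z.obj).inv ≫ f ▷ Z.obj) ▷ v.obj ≫
      (α_ Y.obj Z.obj v.obj).hom ≫ Y.obj ◁ (v.braid.β Z.obj).inv ≫
        (α_ Y.obj v.obj Z.obj).inv ≫ g ▷ Z.obj)
  congr 1
  simp only [Iso.trans_inv, whiskerLeftIso_inv, whiskerRightIso_inv, Iso.symm_inv]
  calc _ = 𝟙 _ ⊗≫ X.obj ◁ (u.braid.β Z.obj).inv ▷ v.obj ⊗≫
        ((X.obj ⊗ u.obj) ◁ (v.braid.β Z.obj).inv ≫ f ▷ (v.obj ⊗ Z.obj)) ⊗≫ g ▷ Z.obj := by monoidal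
    _ = _ := by rw [whisker_exchange]; monoidal

lemma whiskerLeft_id (Z X : Stalk x) : whiskerLeft Z (𝟙 X) = 𝟙 (⟨Z.obj ⊗ X.obj⟩ : Stalk x) := by
  have h := whiskerLeft_map Z (𝟙 X.obj)
  rwa [MonoidalCategory.whiskerLeft_id, (toStalk x).map_id, (toStalk x).map_id] at h

lemma id_whiskerRight (X Z : Stalk x) : whiskerRight (𝟙 X) Z = 𝟙 (⟨X.obj ⊗ Z.obj⟩ : Stalk x) := by
  have h := whiskerRight_map Z (𝟙 X.obj)
  rwa [MonoidalCategory.id_whiskerRight, (toStalk x).map_id, (toStalk x).map_id] at h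

lemma isIso_whiskerLeft (Z : Stalk x) {X Y : Stalk x} (φ : X ⟶ Y) [IsIso φ] :
    IsIso (whiskerLeft Z φ) :=
  ⟨whiskerLeft Z (inv φ), by rw [← whiskerLeft_comp, IsIso.hom_inv_id, whiskerLeft_id],
    by rw [← whiskerLeft_comp, IsIso.inv_hom_id, whiskerLeft_id]⟩

lemma isIso_whiskerRight (Z : Stalk x) {X Y : Stalk x} (φ : X ⟶ Y) [IsIso φ] :
    IsIso (whiskerRight φ Z) :=
  ⟨whiskerRight (inv φ) Z, by rw [← whiskerRight_comp, IsIso.hom_inv_id, id_whiskerRight],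
    by rw [← whiskerRight_comp, IsIso.inv_hom_id, id_whiskerRight]⟩

lemma whisker_exchange' {X Y Z W : Stalk x} (φ : X ⟶ Y) (ψ : Z ⟶ W) :
    whiskerRight φ Z ≫ whiskerLeft Y ψ = whiskerLeft X ψ ≫ whiskerRight φ W := by
  obtain ⟨X⟩ := X
  obtain ⟨Y⟩ := Y
  obtain ⟨Z⟩ := Z
  obtain ⟨W⟩ := W
  obtain ⟨A, e, f, he, hf⟩ := exists_fraction φ
  obtain ⟨B, d, g, hd, hg⟩ := exists_fraction ψ
  have i1 := isIso_whiskerLeft ⟨A⟩ ((toStalk x).map d)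
  have i2 := isIso_whiskerRight ⟨Z⟩ ((toStalk x).map e)
  have ex : ∀ {a b c d : C} (p : a ⟶ b) (q : c ⟶ d),
      whiskerLeft ⟨a⟩ ((toStalk x).map q) ≫ whiskerRight ((toStalk x).map p) ⟨d⟩ =
        whiskerRight ((toStalk x).map p) ⟨c⟩ ≫ whiskerLeft ⟨b⟩ ((toStalk x).map q) := by
    intro a b c d p q
    rw [whiskerLeft_map, whiskerLeft_map, whiskerRight_map, whiskerRight_map]
    exact ((toStalk x).map_comp _ _).symm.trans
      ((congrArg _ (whisker_exchange p q)).trans ((toStalk x).map_comp _ _))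
  rw [← cancel_epi (whiskerRight ((toStalk x).map e) ⟨Z⟩),
    ← cancel_epi (whiskerLeft ⟨A⟩ ((toStalk x).map d))]
  calc _ = whiskerLeft ⟨A⟩ ((toStalk x).map d) ≫ whiskerRight ((toStalk x).map f) ⟨Z⟩ ≫
        whiskerLeft ⟨Y⟩ ψ := by
        rw [← hf, whiskerRight_comp, Category.assoc]
    _ = whiskerRight ((toStalk x).map f) ⟨B⟩ ≫ whiskerLeft ⟨Y⟩ ((toStalk x).map g) := by
        rw [← Category.assoc, ex, Category.assoc, ← whiskerLeft_comp, hg]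
    _ = whiskerLeft ⟨A⟩ ((toStalk x).map g) ≫ whiskerRight ((toStalk x).map e) ⟨W⟩ ≫
        whiskerRight φ ⟨W⟩ := by
        rw [← ex, ← hf, whiskerRight_comp]
    _ = _ := by
        rw [← Category.assoc, ex, Category.assoc, ← hg, whiskerLeft_comp, Category.assoc,
          ← Category.assoc (whiskerRight _ _), ← ex, Category.assoc]

/-- The tensor product of objects is that of `C`, and
`[u, f] ⊗ [v, g] = [u ∧ v, (f ⊗ g) ∘ (A ⊗ σ⁻¹ ⊗ v)]`, with `σ` the half-braiding of `u`. -/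
instance : MonoidalCategoryStruct (Stalk x) where
  tensorObj X Y := ⟨X.obj ⊗ Y.obj⟩
  whiskerLeft Z _ _ φ := whiskerLeft Z φ
  whiskerRight φ Z := whiskerRight φ Z
  tensorHom {_ Y Z _} φ ψ := whiskerRight φ Z ≫ whiskerLeft Y ψ
  tensorUnit := ⟨𝟙_ C⟩
  associator X Y Z := (toStalk x).mapIso (α_ X.obj Y.obj Z.obj)
  leftUnitor X := (toStalk x).mapIso (λ_ X.obj)
  rightUnitor X := (toStalk x).mapIso (ρ_ X.obj)

lemma whiskerLeft_map' (Z : C) {A B : C} (f : A ⟶ B) :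
    (toStalk x).obj Z ◁ (toStalk x).map f = (toStalk x).map (Z ◁ f) := whiskerLeft_map _ _

lemma whiskerRight_map' (Z : C) {A B : C} (f : A ⟶ B) :
    (toStalk x).map f ▷ (toStalk x).obj Z = (toStalk x).map (f ▷ Z) := whiskerRight_map _ _

lemma map_comp_map {A B D : C} (f : A ⟶ B) (g : B ⟶ D) :
    (toStalk x).map f ≫ (toStalk x).map g = (toStalk x).map (f ≫ g) :=
  ((toStalk x).map_comp f g).symm

lemma associator_naturality_left {X Y : Stalk x} (φ : X ⟶ Y) (Z W : Stalk x) :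
    whiskerRight (whiskerRight φ Z) W ≫ (toStalk x).map (α_ Y.obj Z.obj W.obj).hom =
      (toStalk x).map (α_ X.obj Z.obj W.obj).hom ≫ whiskerRight φ ⟨Z.obj ⊗ W.obj⟩ := by
  obtain ⟨X⟩ := X
  obtain ⟨Y⟩ := Y
  obtain ⟨Z⟩ := Z
  obtain ⟨W⟩ := W
  obtain ⟨A, e, f, he, hf⟩ := exists_fraction φ
  have i1 := isIso_whiskerRight ⟨Z⟩ ((toStalk x).map e)
  have i2 := isIso_whiskerRight ⟨W⟩ (whiskerRight ((toStalk x).map e) ⟨Z⟩)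
  rw [← cancel_epi (whiskerRight (whiskerRight ((toStalk x).map e) ⟨Z⟩) ⟨W⟩)]
  calc _ = whiskerRight (whiskerRight ((toStalk x).map f) ⟨Z⟩) ⟨W⟩ ≫
        (toStalk x).map (α_ Y Z W).hom := by
        rw [← Category.assoc, ← whiskerRight_comp, ← whiskerRight_comp, hf]
    _ = (toStalk x).map (α_ A Z W).hom ≫ whiskerRight ((toStalk x).map f) ⟨Z ⊗ W⟩ := by
        rw [whiskerRight_map, whiskerRight_map, whiskerRight_map, map_comp_map, map_comp_map,
          MonoidalCategory.associator_naturality_left]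
    _ = ((toStalk x).map (α_ A Z W).hom ≫ whiskerRight ((toStalk x).map e) ⟨Z ⊗ W⟩) ≫
          whiskerRight φ ⟨Z ⊗ W⟩ := by
        rw [← hf, whiskerRight_comp, Category.assoc]
    _ = _ := by
        rw [whiskerRight_map, whiskerRight_map, whiskerRight_map, map_comp_map,
          ← MonoidalCategory.associator_naturality_left, ← map_comp_map, Category.assoc]

lemma associator_naturality_middle (Z : Stalk x) {X Y : Stalk x} (φ : X ⟶ Y) (W : Stalk x) :
    whiskerRight (whiskerLeft Z φ) W ≫ (toStalk x).map (α_ Z.obj Y.obj W.obj).hom =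
      (toStalk x).map (α_ Z.obj X.obj W.obj).hom ≫ whiskerLeft Z (whiskerRight φ W) := by
  obtain ⟨X⟩ := X
  obtain ⟨Y⟩ := Y
  obtain ⟨Z⟩ := Z
  obtain ⟨W⟩ := W
  obtain ⟨A, e, f, he, hf⟩ := exists_fraction φ
  have i1 := isIso_whiskerLeft ⟨Z⟩ ((toStalk x).map e)
  have i2 := isIso_whiskerRight ⟨W⟩ (whiskerLeft ⟨Z⟩ ((toStalk x).map e))
  rw [← cancel_epi (whiskerRight (whiskerLeft ⟨Z⟩ ((toStalk x).map e)) ⟨W⟩)]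
  calc _ = whiskerRight (whiskerLeft ⟨Z⟩ ((toStalk x).map f)) ⟨W⟩ ≫
        (toStalk x).map (α_ Z Y W).hom := by
        rw [← Category.assoc, ← whiskerRight_comp, ← whiskerLeft_comp, hf]
    _ = (toStalk x).map (α_ Z A W).hom ≫ whiskerLeft ⟨Z⟩ (whiskerRight ((toStalk x).map f) ⟨W⟩) := by
        rw [whiskerRight_map, whiskerLeft_map, whiskerLeft_map, whiskerRight_map, map_comp_map,
          map_comp_map, MonoidalCategory.associator_naturality_middle]
    _ = ((toStalk x).map (α_ Z A W).hom ≫ whiskerLeft ⟨Z⟩ (whiskerRight ((toStalk x).map e) ⟨W⟩)) ≫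
          whiskerLeft ⟨Z⟩ (whiskerRight φ ⟨W⟩) := by
        rw [← hf, whiskerRight_comp, whiskerLeft_comp, Category.assoc]
    _ = _ := by
        rw [whiskerRight_map, whiskerLeft_map, whiskerLeft_map, whiskerRight_map, map_comp_map,
          ← MonoidalCategory.associator_naturality_middle, ← map_comp_map, Category.assoc]

lemma associator_naturality_right (Z W : Stalk x) {X Y : Stalk x} (φ : X ⟶ Y) :
    whiskerLeft ⟨Z.obj ⊗ W.obj⟩ φ ≫ (toStalk x).map (α_ Z.obj W.obj Y.obj).hom =
      (toStalk x).map (α_ Z.obj W.obj X.obj).hom ≫ whiskerLeft Z (whiskerLeft W φ) := by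
  obtain ⟨X⟩ := X
  obtain ⟨Y⟩ := Y
  obtain ⟨Z⟩ := Z
  obtain ⟨W⟩ := W
  obtain ⟨A, e, f, he, hf⟩ := exists_fraction φ
  have i1 := isIso_whiskerLeft ⟨Z ⊗ W⟩ ((toStalk x).map e)
  rw [← cancel_epi (whiskerLeft ⟨Z ⊗ W⟩ ((toStalk x).map e))]
  calc _ = whiskerLeft ⟨Z ⊗ W⟩ ((toStalk x).map f) ≫ (toStalk x).map (α_ Z W Y).hom := by
        rw [← Category.assoc, ← whiskerLeft_comp, hf]
    _ = (toStalk x).map (α_ Z W A).hom ≫ whiskerLeft ⟨Z⟩ (whiskerLeft ⟨W⟩ ((toStalk x).map f)) := by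
        rw [whiskerLeft_map, whiskerLeft_map, whiskerLeft_map, map_comp_map,
          map_comp_map, MonoidalCategory.associator_naturality_right]
    _ = ((toStalk x).map (α_ Z W A).hom ≫ whiskerLeft ⟨Z⟩ (whiskerLeft ⟨W⟩ ((toStalk x).map e))) ≫
          whiskerLeft ⟨Z⟩ (whiskerLeft ⟨W⟩ φ) := by
        rw [← hf, whiskerLeft_comp, whiskerLeft_comp, Category.assoc]
    _ = _ := by
        rw [whiskerLeft_map, whiskerLeft_map, whiskerLeft_map, map_comp_map,
          ← MonoidalCategory.associator_naturality_right, ← map_comp_map, Category.assoc]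

lemma leftUnitor_naturality {X Y : Stalk x} (φ : X ⟶ Y) :
    whiskerLeft ⟨𝟙_ C⟩ φ ≫ (toStalk x).map (λ_ Y.obj).hom = (toStalk x).map (λ_ X.obj).hom ≫ φ := by
  obtain ⟨X⟩ := X
  obtain ⟨Y⟩ := Y
  obtain ⟨A, e, f, he, hf⟩ := exists_fraction φ
  have i1 := isIso_whiskerLeft ⟨𝟙_ C⟩ ((toStalk x).map e)
  rw [← cancel_epi (whiskerLeft ⟨𝟙_ C⟩ ((toStalk x).map e))]
  calc _ = whiskerLeft ⟨𝟙_ C⟩ ((toStalk x).map f) ≫ (toStalk x).map (λ_ Y).hom := by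
        rw [← Category.assoc, ← whiskerLeft_comp, hf]
    _ = (toStalk x).map (λ_ A).hom ≫ (toStalk x).map f := by
        rw [whiskerLeft_map, map_comp_map, map_comp_map, MonoidalCategory.leftUnitor_naturality]
    _ = ((toStalk x).map (λ_ A).hom ≫ (toStalk x).map e) ≫ φ := by
        rw [← hf, Category.assoc]
    _ = _ := by
        rw [whiskerLeft_map, map_comp_map, ← MonoidalCategory.leftUnitor_naturality,
          ← map_comp_map, Category.assoc]

lemma rightUnitor_naturality {X Y : Stalk x} (φ : X ⟶ Y) :
    whiskerRight φ ⟨𝟙_ C⟩ ≫ (toStalk x).map (ρ_ Y.obj).hom =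
      (toStalk x).map (ρ_ X.obj).hom ≫ φ := by
  obtain ⟨X⟩ := X
  obtain ⟨Y⟩ := Y
  obtain ⟨A, e, f, he, hf⟩ := exists_fraction φ
  have i1 := isIso_whiskerRight ⟨𝟙_ C⟩ ((toStalk x).map e)
  rw [← cancel_epi (whiskerRight ((toStalk x).map e) ⟨𝟙_ C⟩)]
  calc _ = whiskerRight ((toStalk x).map f) ⟨𝟙_ C⟩ ≫ (toStalk x).map (ρ_ Y).hom := by
        rw [← Category.assoc, ← whiskerRight_comp, hf]
    _ = (toStalk x).map (ρ_ A).hom ≫ (toStalk x).map f := by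
        rw [whiskerRight_map, map_comp_map, map_comp_map, MonoidalCategory.rightUnitor_naturality]
    _ = ((toStalk x).map (ρ_ A).hom ≫ (toStalk x).map e) ≫ φ := by
        rw [← hf, Category.assoc]
    _ = _ := by
        rw [whiskerRight_map, map_comp_map, ← MonoidalCategory.rightUnitor_naturality,
          ← map_comp_map, Category.assoc]

instance : MonoidalCategory (Stalk x) where
  tensorHom_def _ _ := rfl
  id_tensorHom_id X Y := by
    change whiskerRight (𝟙 X) Y ≫ whiskerLeft X (𝟙 Y) = 𝟙 (⟨X.obj ⊗ Y.obj⟩ : Stalk x)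
    rw [whiskerLeft_id, id_whiskerRight, Category.comp_id]
  tensorHom_comp_tensorHom {X₁ Y₁ Z₁ X₂ Y₂ Z₂} f₁ f₂ g₁ g₂ := by
    change (whiskerRight f₁ X₂ ≫ whiskerLeft Y₁ f₂) ≫ whiskerRight g₁ Y₂ ≫ whiskerLeft Z₁ g₂ =
      whiskerRight (f₁ ≫ g₁) X₂ ≫ whiskerLeft Z₁ (f₂ ≫ g₂)
    rw [whiskerRight_comp, whiskerLeft_comp, Category.assoc, Category.assoc,
      ← Category.assoc (whiskerLeft _ _), ← whisker_exchange', Category.assoc]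
  whiskerLeft_id := whiskerLeft_id
  id_whiskerRight := id_whiskerRight
  associator_naturality {X₁ X₂ X₃ Y₁ Y₂ Y₃} f₁ f₂ f₃ := by
    change (whiskerRight (whiskerRight f₁ X₂ ≫ whiskerLeft Y₁ f₂) X₃ ≫
      whiskerLeft ⟨Y₁.obj ⊗ Y₂.obj⟩ f₃) ≫ (toStalk x).map (α_ Y₁.obj Y₂.obj Y₃.obj).hom =
      (toStalk x).map (α_ X₁.obj X₂.obj X₃.obj).hom ≫
        whiskerRight f₁ ⟨X₂.obj ⊗ X₃.obj⟩ ≫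
          whiskerLeft Y₁ (whiskerRight f₂ X₃ ≫ whiskerLeft Y₂ f₃)
    rw [whiskerRight_comp, whiskerLeft_comp, Category.assoc, Category.assoc,
      associator_naturality_right, ← Category.assoc (whiskerRight (whiskerLeft _ _) _),
      associator_naturality_middle, ← Category.assoc ((toStalk x).map _),
      ← associator_naturality_left]
    simp only [Category.assoc]
  leftUnitor_naturality φ := leftUnitor_naturality φ
  rightUnitor_naturality φ := rightUnitor_naturality φ
  pentagon W X Y Z := by
    change whiskerRight ((toStalk x).map (α_ W.obj X.obj Y.obj).hom) Z ≫
      (toStalk x).map (α_ W.obj (X.obj ⊗ Y.obj) Z.obj).hom ≫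
      whiskerLeft W ((toStalk x).map (α_ X.obj Y.obj Z.obj).hom) =
      (toStalk x).map (α_ (W.obj ⊗ X.obj) Y.obj Z.obj).hom ≫
      (toStalk x).map (α_ W.obj X.obj (Y.obj ⊗ Z.obj)).hom
    rw [whiskerRight_map, whiskerLeft_map, map_comp_map, map_comp_map, map_comp_map,
      MonoidalCategory.pentagon]
  triangle X Y := by
    change (toStalk x).map (α_ X.obj (𝟙_ C) Y.obj).hom ≫
      whiskerLeft X ((toStalk x).map (λ_ Y.obj).hom) =
      whiskerRight ((toStalk x).map (ρ_ X.obj).hom) Y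
    rw [whiskerRight_map, whiskerLeft_map, map_comp_map, MonoidalCategory.triangle]

/-- The quotient functor is strict monoidal. -/
instance : (toStalk x).Monoidal :=
  Functor.CoreMonoidal.toMonoidal
    { εIso := Iso.refl _
      μIso := fun _ _ => Iso.refl _
      μIso_hom_natural_left := fun f Z => by
        change whiskerRight ((toStalk x).map f) ⟨Z⟩ ≫ 𝟙 _ = 𝟙 _ ≫ (toStalk x).map (f ▷ Z)
        rw [whiskerRight_map, Category.comp_id, Category.id_comp]
      μIso_hom_natural_right := fun Z f => by
        change whiskerLeft ⟨Z⟩ ((toStalk x).map f) ≫ 𝟙 _ = 𝟙 _ ≫ (toStalk x).map (Z ◁ f)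
        rw [whiskerLeft_map, Category.comp_id, Category.id_comp]
      associativity := fun X Y Z => by
        change whiskerRight (𝟙 _) ⟨Z⟩ ≫ 𝟙 _ ≫ (toStalk x).map (α_ X Y Z).hom =
          (toStalk x).map (α_ X Y Z).hom ≫ whiskerLeft ⟨X⟩ (𝟙 _) ≫ 𝟙 _
        rw [whiskerLeft_id, id_whiskerRight]
        simp only [Category.comp_id, Category.id_comp]
      left_unitality := fun X => by
        change (toStalk x).map (λ_ X).hom =
          whiskerRight (𝟙 _) ⟨X⟩ ≫ 𝟙 _ ≫ (toStalk x).map (λ_ X).hom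
        rw [id_whiskerRight]
        simp only [Category.id_comp]
      right_unitality := fun X => by
        change (toStalk x).map (ρ_ X).hom =
          whiskerLeft ⟨X⟩ (𝟙 _) ≫ 𝟙 _ ≫ (toStalk x).map (ρ_ X).hom
        rw [whiskerLeft_id]
        simp only [Category.id_comp] }

end Stalk

end Stalk

section UniversalJoins

open CategoryTheory.Limits

/-- `C` has universal finite joins of central idempotents: it has an initial object `0` that is
absorbing for the tensor product, and any two central idempotents `u`, `v` have a join `w` in
`ZI(C)` such that for every object `A` the square
```
A ⊗ U ⊗ V ⟶ A ⊗ V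
    |         |
    v         v
  A ⊗ U   ⟶ A ⊗ W
```
is both a pullback and a pushout. -/
structure HasUniversalFiniteJoins (C : Type u) [Category.{v} C] [MonoidalCategory C] : Prop where
  exists_zero : ∃ Z : C, Nonempty (IsInitial Z) ∧
    ∀ A : C, Nonempty (A ⊗ Z ≅ Z) ∧ Nonempty (Z ⊗ A ≅ Z)
  exists_join : ∀ u v : CentralIdempotent C, ∃ (w : CentralIdempotent C)
    (i : CentralIdempotent.Hom u w) (j : CentralIdempotent.Hom v w),
    IsLUB {u.toZI, v.toZI} w.toZI ∧
    ∀ A : C, BicartesianSq (A ◁ (u.tensorFst v).hom) (A ◁ (u.tensorSnd v).hom)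
      (A ◁ i.hom) (A ◁ j.hom)

/-- A prime filter: a nonempty, upward-closed, downward-directed, proper subset that contains one
of `a`, `b` whenever it contains their join. -/
structure PrimeFilter (P : Type u) [PartialOrder P] where
  filter : Order.PFilter P
  proper : ∃ a : P, a ∉ filter
  prime : ∀ a b c : P, IsLUB {a, b} c → c ∈ filter → a ∈ filter ∨ b ∈ filter

/-- A partially ordered set with top `1` is `∨`-local when it has at least two elements and
`a ∨ b = 1` only if `a = 1` or `b = 1`. -/
def IsVeeLocalOrder (P : Type u) [PartialOrder P] [OrderTop P] : Prop :=
  Nontrivial P ∧ ∀ a b : P, IsLUB {a, b} ⊤ → a = ⊤ ∨ b = ⊤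

/-- A monoidal category is `∨`-local when its poset of central idempotents is. -/
def IsVeeLocal (C : Type u) [Category.{v} C] [MonoidalCategory C] : Prop :=
  IsVeeLocalOrder (ZI C)

/-- The functor from `C` to the product of its stalks at the prime filters of central idempotents,
whose components are the quotient functors; it is the identity on objects in each component. -/
def toStalks (C : Type u) [Category.{v} C] [MonoidalCategory C] :
    C ⥤ (∀ x : PrimeFilter (ZI C), Stalk x.filter) :=
  Functor.pi' fun x => Stalk.toStalk x.filter

end UniversalJoins

/-!
Two morphisms `f, g : A ⟶ B` agree in the stalk at `x` exactly when `f ▷ U = g ▷ U` for some `U` in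
`x`. The pushout squares show that `ZI C` is a distributive lattice and that the central idempotents
on which `f` and `g` agree form an ideal. If `f ≠ g`, this ideal is proper, hence disjoint from some
prime filter by the prime ideal theorem, and `f` and `g` stay distinct in the stalk there.

In the braided case a central idempotent of the stalk at `x` is a fraction of morphisms of `C` that
satisfies the axioms after restriction to some member of `x`, and tensoring with that member lifts
it to `C`; the braiding supplies the half-braiding of the lift. Moreover `u` becomes trivial in the
stalk exactly when it belongs to `x`, so that primality of `x` is `∨`-locality of the stalk.

Without a braiding, `C` acts faithfully on itself by tensoring, within the endofunctors of `C` with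
an initial object adjoined that preserve this object. The half-braiding of a central idempotent of
the category of such endofunctors with the constant functors leaves only `0` and `1`.
-/

section Order

lemma PrimeFilter.exists_disjoint {P : Type u} [DistribLattice P] [OrderTop P]
    (I : Order.Ideal P) (hI : ⊤ ∉ I) : ∃ x : PrimeFilter P, ∀ a ∈ x.filter, a ∉ I := by
  have top_disjoint : Disjoint (Order.PFilter.principal (⊤ : P) : Set P) I := by
    refine Set.disjoint_left.2 fun a ha => ?_
    rwa [top_le_iff.1 (Order.PFilter.mem_principal.1 ha)]
  obtain ⟨J, hJ, hIJ, _⟩ := DistribLattice.prime_ideal_of_disjoint_filter_ideal top_disjoint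
  obtain ⟨b, hb⟩ := J.nonempty
  refine ⟨⟨hJ.compl_filter.toPFilter, ⟨b, not_not_intro hb⟩, fun a b c hc hcJ => ?_⟩,
    fun a haJ haI => haJ (hIJ haI)⟩
  by_contra! hab
  refine hcJ ?_
  rw [hc.unique isLUB_pair]
  exact J.sup_mem (not_not.1 hab.1) (not_not.1 hab.2)

lemma PrimeFilter.nonempty (P : Type u) [DistribLattice P] [OrderTop P] [Nontrivial P] :
    Nonempty (PrimeFilter P) := by
  obtain ⟨a, ha⟩ := exists_ne (⊤ : P)
  obtain ⟨x, _⟩ := exists_disjoint (Order.Ideal.principal a)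
    fun h => ha (top_le_iff.1 (Order.Ideal.mem_principal.1 h))
  exact ⟨x⟩

lemma IsVeeLocalOrder.of_eq_top_or_le {P : Type u} [PartialOrder P] [OrderTop P] {b : P}
    (hb : b ≠ ⊤) (h : ∀ a : P, a = ⊤ ∨ a ≤ b) : IsVeeLocalOrder P := by
  refine ⟨⟨b, ⊤, hb⟩, fun a c hac => ?_⟩
  by_contra! hne
  refine hb (top_le_iff.1 (hac.2 ?_))
  rintro _ (rfl | rfl)
  exacts [(h _).resolve_left hne.1, (h _).resolve_left hne.2]

end Order

section CentralIdempotents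

variable {C : Type u} [Category.{v} C]

lemma isIso_of_two_out_of_six {A B D E : C} (f : A ⟶ B) (g : B ⟶ D) (h : D ⟶ E)
    [IsIso (f ≫ g)] [IsIso (g ≫ h)] : IsIso h := by
  have : IsSplitEpi g := ⟨⟨inv (f ≫ g) ≫ f, by simp⟩⟩
  have : IsSplitMono g := ⟨⟨h ≫ inv (g ≫ h), by simp [← Category.assoc]⟩⟩
  have : IsIso g := isIso_of_mono_of_isSplitEpi g
  exact IsIso.of_isIso_comp_left g h

variable [MonoidalCategory C]

namespace CentralIdempotent

open Limits

variable {u v w : CentralIdempotent C} {A B : C}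

lemma exists_toZI_eq (a : ZI C) : ∃ u : CentralIdempotent C, u.toZI = a :=
  Quotient.exists_rep a

lemma Hom.toZI_le (m : Hom u v) : u.toZI ≤ v.toZI := ⟨m⟩

lemma Hom.hom_eq (m n : Hom u v) : m.hom = n.hom := fac_unique _ _ m.fac n.fac

/-- The action of `u ⊗ -` on morphisms of central idempotents. -/
def Hom.whiskerLeft (u : CentralIdempotent C) (m : Hom v w) : Hom (u.tensor v) (u.tensor w) :=
  .ofFac (u.obj ◁ m.hom) (by
    rw [← id_tensorHom]
    exact ((Hom.id u).tensor m).fac)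

lemma toZI_eq_of_isIso (e : u.obj ⟶ v.obj) [IsIso e] (h : e ≫ v.hom = u.hom) :
    u.toZI = v.toZI :=
  Quotient.sound ⟨.ofFac e h, ‹_›⟩

instance : SemilatticeInf (ZI C) where
  inf := Quotient.map₂ tensor fun _ _ ⟨m, _⟩ _ _ ⟨n, _⟩ =>
    ⟨m.tensor n, inferInstanceAs (IsIso (m.hom ⊗ₘ n.hom))⟩
  inf_le_left := by rintro ⟨u⟩ ⟨v⟩; exact (u.tensorFst v).toZI_le
  inf_le_right := by rintro ⟨u⟩ ⟨v⟩; exact (u.tensorSnd v).toZI_le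
  le_inf := by rintro ⟨u⟩ ⟨v⟩ ⟨w⟩ ⟨m⟩ ⟨n⟩; exact (m.lift n).toZI_le

lemma toZI_inf_toZI (u v : CentralIdempotent C) : u.toZI ⊓ v.toZI = (u.tensor v).toZI := rfl

lemma toZI_le_iff_isIso_whiskerRight : w.toZI ≤ u.toZI ↔ IsIso (u.hom ▷ w.obj) := by
  constructor
  · rintro ⟨m⟩
    have : IsIso (u.hom ▷ w.obj ≫ (λ_ w.obj).hom) :=
      isIso_of_hom_hom (tensorSnd u w) (m.lift (.id w))
    exact IsIso.of_isIso_comp_right _ (λ_ w.obj).hom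
  · intro _
    have : IsIso (tensorSnd u w).hom :=
      inferInstanceAs (IsIso (u.hom ▷ w.obj ≫ (λ_ w.obj).hom))
    exact (toZI_eq_of_isIso _ (tensorSnd u w).fac).ge.trans (tensorFst u w).toZI_le

lemma toZI_eq_top_iff_isIso_hom : u.toZI = ⊤ ↔ IsIso u.hom := by
  rw [← top_le_iff]
  exact toZI_le_iff_isIso_whiskerRight.trans (NatIso.isIso_map_iff (rightUnitorNatIso C) u.hom)

/-- The zero idempotent, on an object that is initial after tensoring on either side. -/
def ofIsInitial {Z : C} (hl : ∀ A, IsInitial (A ⊗ Z)) (hr : ∀ A, IsInitial (Z ⊗ A)) :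
    CentralIdempotent C where
  obj := Z
  hom := (λ_ Z).inv ≫ (hl (𝟙_ C)).to (𝟙_ C)
  braid :=
    { β A := (hr A).uniqueUpToIso (hl A)
      monoidal _ _ := (hr _).hom_ext _ _
      naturality _ := (hr _).hom_ext _ _ }
  hom_braid A := (hr A).hom_ext _ _
  central := (hr Z).hom_ext _ _
  isIso_left := isIso_of_isInitial (hr Z) ((hl (𝟙_ C)).ofIso (λ_ Z)) _

lemma isBot_toZI_of_isInitial (hu : IsInitial u.obj) : IsBot u.toZI := fun a => by
  obtain ⟨v, rfl⟩ := exists_toZI_eq a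
  exact (Hom.ofFac (hu.to v.obj) (hu.hom_ext _ _)).toZI_le

lemma whiskerRight_eq_of_toZI_le {f g : A ⟶ B} (h : v.toZI ≤ w.toZI)
    (hfg : f ▷ w.obj = g ▷ w.obj) : f ▷ v.obj = g ▷ v.obj := by
  have := toZI_le_iff_isIso_whiskerRight.1 h
  rw [← cancel_epi (A ◁ (w.hom ▷ v.obj ≫ (λ_ v.obj).hom)), whisker_exchange, whisker_exchange,
    whiskerRight_tensor, whiskerRight_tensor, hfg]

lemma isIso_whiskerRight_of_toZI_le {f : A ⟶ B} (h : v.toZI ≤ w.toZI) [IsIso (f ▷ w.obj)] :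
    IsIso (f ▷ v.obj) := by
  have := toZI_le_iff_isIso_whiskerRight.1 h
  have : IsIso (A ◁ (w.hom ▷ v.obj ≫ (λ_ v.obj).hom) ≫ f ▷ v.obj) := by
    rw [whisker_exchange, whiskerRight_tensor]
    infer_instance
  exact IsIso.of_isIso_comp_left (A ◁ (w.hom ▷ v.obj ≫ (λ_ v.obj).hom)) _

end CentralIdempotent

end CentralIdempotents

section Separation

variable {C : Type u} [Category.{v} C] [MonoidalCategory C]

open CentralIdempotent

namespace Stalk

variable {v w : CentralIdempotent C} {x : Order.PFilter (ZI C)} {A B : C}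

lemma counit_naturality (w : CentralIdempotent C) (f : A ⟶ B) :
    counit A w ≫ f = f ▷ w.obj ≫ counit B w := by
  rw [counit, counit, ← whisker_exchange_assoc,
    MonoidalCategory.rightUnitor_naturality, Category.assoc]

lemma isIso_counit_whiskerRight (A : C) (h : v.toZI ≤ w.toZI) :
    IsIso (counit A w ▷ v.obj) := by
  have := toZI_le_iff_isIso_whiskerRight.1 h
  have : counit A w ▷ v.obj =
      (α_ A w.obj v.obj).hom ≫ A ◁ (w.hom ▷ v.obj) ≫ A ◁ (λ_ v.obj).hom := by
    rw [counit]
    monoidal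
  rw [this]
  infer_instance

lemma counit_comp_eq_iff {f g : A ⟶ B} :
    counit A w ≫ f = counit A w ≫ g ↔ f ▷ w.obj = g ▷ w.obj := by
  have := isIso_counit_whiskerRight A (le_refl w.toZI)
  refine ⟨fun h => ?_, fun h => by rw [counit_naturality, counit_naturality, h]⟩
  rw [← cancel_epi (counit A w ▷ w.obj), ← comp_whiskerRight, h, comp_whiskerRight]

lemma map_eq_map_iff {f g : A ⟶ B} : (toStalk x).map f = (toStalk x).map g ↔
    ∃ w : CentralIdempotent C, w.toZI ∈ x ∧ f ▷ w.obj = g ▷ w.obj := by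
  simp only [← counit_comp_eq_iff]
  constructor
  · intro h
    obtain ⟨w, hw, m, n, e⟩ : Germ.Rel _ _ := Quotient.exact h
    rw [m.hom_eq w.toUnit, n.hom_eq w.toUnit] at e
    refine ⟨w, hw, ?_⟩
    rw [counit, Category.assoc, Category.assoc]
    exact e
  · rintro ⟨w, hw, h⟩
    rw [counit, Category.assoc, Category.assoc] at h
    exact germ_eq hw w.toUnit w.toUnit h

end Stalk

namespace HasUniversalFiniteJoins

open Limits

variable (hC : HasUniversalFiniteJoins C)

include hC

lemma exists_isLUB (a b : ZI C) : ∃ c, IsLUB {a, b} c := by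
  obtain ⟨u, rfl⟩ := exists_toZI_eq a
  obtain ⟨v, rfl⟩ := exists_toZI_eq b
  obtain ⟨w, _, _, hw, _⟩ := hC.exists_join u v
  exact ⟨_, hw⟩

lemma inf_le_of_isLUB {a b c d s : ZI C} (hd : IsLUB {b, c} d) (hb : a ⊓ b ≤ s)
    (hc : a ⊓ c ≤ s) : a ⊓ d ≤ s := by
  obtain ⟨u, rfl⟩ := exists_toZI_eq a
  obtain ⟨v, rfl⟩ := exists_toZI_eq b
  obtain ⟨w, rfl⟩ := exists_toZI_eq c
  obtain ⟨t, rfl⟩ := exists_toZI_eq s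
  obtain ⟨m⟩ : (u.tensor v).toZI ≤ t.toZI := hb
  obtain ⟨n⟩ : (u.tensor w).toZI ≤ t.toZI := hc
  obtain ⟨j, jv, jw, hj, hsq⟩ := hC.exists_join v w
  rw [hd.unique hj, toZI_inf_toZI]
  have hp := (hsq u.obj).toIsPushout
  have agree : u.obj ◁ (tensorFst v w).hom ≫ m.hom = u.obj ◁ (tensorSnd v w).hom ≫ n.hom :=
    Hom.hom_eq (((tensorFst v w).whiskerLeft u).comp m) (((tensorSnd v w).whiskerLeft u).comp n)
  refine (Hom.ofFac (u := u.tensor j) (hp.desc m.hom n.hom agree) (hp.hom_ext ?_ ?_)).toZI_le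
  · rw [hp.inl_desc_assoc, m.fac]
    exact (jv.whiskerLeft u).fac.symm
  · rw [hp.inr_desc_assoc, n.fac]
    exact (jw.whiskerLeft u).fac.symm

/-- The distributive lattice of central idempotents: its meets are tensor products and its joins
are chosen. -/
noncomputable abbrev distribLattice : DistribLattice (ZI C) :=
  letI : Lattice (ZI C) :=
    { (inferInstance : SemilatticeInf (ZI C)) with
      sup a b := (hC.exists_isLUB a b).choose
      le_sup_left a b := (hC.exists_isLUB a b).choose_spec.1 (Set.mem_insert _ _)
      le_sup_right a b := (hC.exists_isLUB a b).choose_spec.1 (Set.mem_insert_of_mem _ rfl)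
      sup_le a b c hac hbc := (hC.exists_isLUB a b).choose_spec.2 (by
        rintro _ (rfl | rfl) <;> assumption) }
  .ofInfSupLe fun _ _ _ =>
    hC.inf_le_of_isLUB (hC.exists_isLUB _ _).choose_spec le_sup_left le_sup_right

lemma exists_isInitial_tensor :
    ∃ z : CentralIdempotent C, ∀ A, Nonempty (IsInitial (A ⊗ z.obj)) := by
  obtain ⟨Z, ⟨hZ⟩, h⟩ := hC.exists_zero
  have hl (A : C) : IsInitial (A ⊗ Z) := hZ.ofIso (h A).1.some.symm
  have hr (A : C) : IsInitial (Z ⊗ A) := hZ.ofIso (h A).2.some.symm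
  exact ⟨ofIsInitial hl hr, fun A => ⟨hl A⟩⟩

lemma whiskerRight_eq_of_isLUB {A B : C} {f g : A ⟶ B} {u v w : CentralIdempotent C}
    (hw : IsLUB {u.toZI, v.toZI} w.toZI) (hu : f ▷ u.obj = g ▷ u.obj)
    (hv : f ▷ v.obj = g ▷ v.obj) : f ▷ w.obj = g ▷ w.obj := by
  obtain ⟨j, ju, jv, hj, hsq⟩ := hC.exists_join u v
  refine whiskerRight_eq_of_toZI_le (hw.unique hj).le ((hsq A).toIsPushout.hom_ext ?_ ?_)
  · rw [whisker_exchange, whisker_exchange, hu]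
  · rw [whisker_exchange, whisker_exchange, hv]

/-- The ideal of the central idempotents on which two parallel morphisms agree. -/
def agreementIdeal {A B : C} (f g : A ⟶ B) : Order.Ideal (ZI C) where
  carrier := {a | ∃ u : CentralIdempotent C, u.toZI = a ∧ f ▷ u.obj = g ▷ u.obj}
  lower' := by
    rintro _ b hb ⟨u, rfl, hu⟩
    obtain ⟨v, rfl⟩ := exists_toZI_eq b
    exact ⟨v, rfl, whiskerRight_eq_of_toZI_le hb hu⟩
  nonempty' := by
    obtain ⟨z, hz⟩ := hC.exists_isInitial_tensor
    exact ⟨_, z, rfl, (hz A).some.hom_ext _ _⟩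
  directed' := by
    rintro _ ⟨u, rfl, hu⟩ _ ⟨v, rfl, hv⟩
    obtain ⟨w, i, j, hw, _⟩ := hC.exists_join u v
    exact ⟨_, ⟨w, rfl, hC.whiskerRight_eq_of_isLUB hw hu hv⟩, i.toZI_le, j.toZI_le⟩

lemma faithful_toStalks : (toStalks C).Faithful where
  map_injective {A B f g} h := by
    by_contra hne
    let := hC.distribLattice
    have top_notMem : ⊤ ∉ hC.agreementIdeal f g := by
      rintro ⟨u, hu, hfg⟩
      exact hne ((whiskerRight_iff f g).1 (whiskerRight_eq_of_toZI_le (v := unit) hu.ge hfg))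
    obtain ⟨x, hx⟩ := PrimeFilter.exists_disjoint _ top_notMem
    obtain ⟨w, hw, hfg⟩ := Stalk.map_eq_map_iff.1 (congrFun h x)
    exact hx _ hw ⟨w, rfl, hfg⟩

lemma nonempty_primeFilter [Nontrivial (ZI C)] : Nonempty (PrimeFilter (ZI C)) :=
  let := hC.distribLattice
  PrimeFilter.nonempty (ZI C)

end HasUniversalFiniteJoins

lemma toStalks_obj_injective [Nonempty (PrimeFilter (ZI C))] :
    Function.Injective (toStalks C).obj := fun _ _ h =>
  congrArg Stalk.obj (congrFun h (Classical.arbitrary _))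

instance : (toStalks C).Monoidal :=
  inferInstanceAs (Functor.pi' fun x : PrimeFilter (ZI C) => Stalk.toStalk x.filter).Monoidal

end Separation

section StalkIdempotents

variable {C : Type u} [Category.{v} C] [MonoidalCategory C]

open CentralIdempotent

namespace Stalk

variable {x : Order.PFilter (ZI C)} {A B : C}

lemma isIso_map_iff {f : A ⟶ B} : IsIso ((toStalk x).map f) ↔
    ∃ w : CentralIdempotent C, w.toZI ∈ x ∧ IsIso (f ▷ w.obj) := by
  constructor
  · rintro ⟨φ, hfφ, hφf⟩
    induction φ using ind with | h v hv g =>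
    have hg := toStalk_counit_comp_germ v hv g
    have comp_right : (toStalk x).map (g ≫ f) = (toStalk x).map (counit B v) := by
      rw [(toStalk x).map_comp, ← hg, Category.assoc, hφf, Category.comp_id]
    have comp_left : (toStalk x).map (f ▷ v.obj ≫ g) = (toStalk x).map (counit A v) := by
      rw [(toStalk x).map_comp, ← hg, ← Category.assoc, map_comp_map, ← counit_naturality,
        (toStalk x).map_comp, Category.assoc, hfφ, Category.comp_id]
    obtain ⟨w₁, hw₁, h₁⟩ := map_eq_map_iff.1 comp_right
    obtain ⟨w₂, hw₂, h₂⟩ := map_eq_map_iff.1 comp_left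
    let w := v.tensor (w₁.tensor w₂)
    have hwv : w.toZI ≤ v.toZI := (tensorFst _ _).toZI_le
    have hww₁ : w.toZI ≤ w₁.toZI := ((tensorSnd v _).comp (tensorFst w₁ w₂)).toZI_le
    have hww₂ : w.toZI ≤ w₂.toZI := ((tensorSnd v _).comp (tensorSnd w₁ w₂)).toZI_le
    refine ⟨w, tensor_mem hv (tensor_mem hw₁ hw₂), ?_⟩
    have : IsIso (g ▷ w.obj ≫ f ▷ w.obj) := by
      rw [← comp_whiskerRight, whiskerRight_eq_of_toZI_le hww₁ h₁]
      exact isIso_counit_whiskerRight B hwv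
    have : IsIso (f ▷ v.obj ▷ w.obj ≫ g ▷ w.obj) := by
      rw [← comp_whiskerRight, whiskerRight_eq_of_toZI_le hww₂ h₂]
      exact isIso_counit_whiskerRight A hwv
    exact isIso_of_two_out_of_six (f ▷ v.obj ▷ w.obj) (g ▷ w.obj) (f ▷ w.obj)
  · rintro ⟨w, hw, _⟩
    have := isIso_toStalk_counit A w hw
    have := isIso_toStalk_counit B w hw
    have : IsIso ((toStalk x).map (counit A w) ≫ (toStalk x).map f) := by
      have := (toStalk x).map_isIso (f ▷ w.obj)
      rw [map_comp_map, counit_naturality, ← map_comp_map]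
      exact IsIso.comp_isIso
    exact IsIso.of_isIso_comp_left ((toStalk x).map (counit A w)) _

/-- Every morphism of the stalk is a fraction of morphisms of `C`, so that only the latter need to
be tested. -/
lemma naturality_of_map {D : Type*} [Category* D] {G H : Stalk x ⥤ D}
    (τ : ∀ X, G.obj X ⟶ H.obj X)
    (hτ : ∀ {A B : C} (f : A ⟶ B), G.map ((toStalk x).map f) ≫ τ ⟨B⟩ =
      τ ⟨A⟩ ≫ H.map ((toStalk x).map f)) {X Y : Stalk x} (φ : X ⟶ Y) :
    G.map φ ≫ τ Y = τ X ≫ H.map φ := by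
  obtain ⟨A, e, f, _, hf⟩ := exists_fraction φ
  rw [← cancel_epi (G.map ((toStalk x).map e))]
  calc G.map ((toStalk x).map e) ≫ G.map φ ≫ τ Y
    _ = G.map ((toStalk x).map f) ≫ τ Y := by rw [← G.map_comp_assoc, hf]
    _ = τ ⟨A⟩ ≫ H.map ((toStalk x).map e) ≫ H.map φ := by rw [hτ f, ← hf, H.map_comp]
    _ = G.map ((toStalk x).map e) ≫ τ X ≫ H.map φ := by rw [reassoc_of% hτ e]

lemma map_whiskerRight_comp_leftUnitor (f : B ⟶ 𝟙_ C) (A : C) :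
    (toStalk x).map f ▷ (⟨A⟩ : Stalk x) ≫ (λ_ (⟨A⟩ : Stalk x)).hom =
      (toStalk x).map (f ▷ A ≫ (λ_ A).hom) := by
  rw [← map_comp_map, ← whiskerRight_map']
  rfl

lemma whiskerLeft_map_comp_rightUnitor (A : C) (f : B ⟶ 𝟙_ C) :
    (⟨A⟩ : Stalk x) ◁ (toStalk x).map f ≫ (ρ_ (⟨A⟩ : Stalk x)).hom =
      (toStalk x).map (A ◁ f ≫ (ρ_ A).hom) := by
  rw [← map_comp_map, ← whiskerLeft_map']
  rfl

/-- The central idempotent of the stalk represented by a central idempotent of `C`. -/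
def mapIdem (x : Order.PFilter (ZI C)) (u : CentralIdempotent C) :
    CentralIdempotent (Stalk x) where
  obj := ⟨u.obj⟩
  hom := (toStalk x).map u.hom
  braid :=
    { β X := (toStalk x).mapIso (u.braid.β X.obj)
      monoidal X Y := by
        change (toStalk x).map (u.braid.β (X.obj ⊗ Y.obj)).hom =
          (toStalk x).map (α_ u.obj X.obj Y.obj).inv ≫
            whiskerRight ((toStalk x).map (u.braid.β X.obj).hom) Y ≫
              (toStalk x).map (α_ X.obj u.obj Y.obj).hom ≫
                whiskerLeft X ((toStalk x).map (u.braid.β Y.obj).hom) ≫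
                  (toStalk x).map (α_ X.obj Y.obj u.obj).inv
        rw [whiskerLeft_map, whiskerRight_map, map_comp_map, map_comp_map, map_comp_map,
          map_comp_map, u.braid.monoidal]
      naturality := naturality_of_map
        (G := (tensoringLeft (Stalk x)).obj ⟨u.obj⟩) (H := (tensoringRight (Stalk x)).obj ⟨u.obj⟩)
        (fun X => (toStalk x).map (u.braid.β X.obj).hom) fun {A B} f => by
          change whiskerLeft ⟨u.obj⟩ ((toStalk x).map f) ≫ (toStalk x).map (u.braid.β B).hom =
            (toStalk x).map (u.braid.β A).hom ≫ whiskerRight ((toStalk x).map f) ⟨u.obj⟩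
          rw [whiskerLeft_map, whiskerRight_map, map_comp_map, map_comp_map, u.braid.naturality] }
  hom_braid X := by
    rw [map_whiskerRight_comp_leftUnitor, whiskerLeft_map_comp_rightUnitor, ← u.hom_braid X.obj]
    exact map_comp_map _ _
  central := by
    rw [map_whiskerRight_comp_leftUnitor, whiskerLeft_map_comp_rightUnitor, u.central]
  isIso_left := by
    rw [map_whiskerRight_comp_leftUnitor]
    exact (toStalk x).map_isIso (u.hom ▷ u.obj ≫ (λ_ u.obj).hom)

lemma mapIdem_mono {u v : CentralIdempotent C} (h : u.toZI ≤ v.toZI) :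
    (mapIdem x u).toZI ≤ (mapIdem x v).toZI := by
  obtain ⟨m⟩ := h
  have hm : (toStalk x).map m.hom ≫ (toStalk x).map v.hom = (toStalk x).map u.hom := by
    rw [map_comp_map, m.fac]
  exact (Hom.ofFac (u := mapIdem x u) (v := mapIdem x v) _ hm).toZI_le

lemma mapIdem_eq_top_iff {u : CentralIdempotent C} :
    (mapIdem x u).toZI = ⊤ ↔ u.toZI ∈ x := by
  refine toZI_eq_top_iff_isIso_hom.trans (isIso_map_iff.trans ?_)
  simp only [← toZI_le_iff_isIso_whiskerRight]
  exact ⟨fun ⟨w, hw, hwu⟩ => x.mem_of_le hwu hw, fun hu => ⟨u, hu, le_rfl⟩⟩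

end Stalk

end StalkIdempotents

section Lifting

variable {C : Type u} [Category.{v} C] [MonoidalCategory C]

namespace CentralIdempotent

/-- The isomorphism `(A ⊗ w) ⊗ (A ⊗ w) ≅ (A ⊗ A) ⊗ (w ⊗ w)` that moves `w` past `A` by its
half-braiding, so that `A ⊗ w` can be compared with itself over `A ⊗ A`. -/
def shuffle (A : C) (w : CentralIdempotent C) :
    (A ⊗ w.obj) ⊗ (A ⊗ w.obj) ≅ (A ⊗ A) ⊗ (w.obj ⊗ w.obj) :=
  α_ A w.obj (A ⊗ w.obj) ≪≫ whiskerLeftIso A ((α_ w.obj A w.obj).symm ≪≫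
    whiskerRightIso (w.braid.β A) w.obj ≪≫ α_ A w.obj w.obj) ≪≫ (α_ A A (w.obj ⊗ w.obj)).symm

variable {A : C} (f : A ⟶ 𝟙_ C) (w : CentralIdempotent C)

lemma counit_comp_whiskerRight :
    (Stalk.counit A w ≫ f) ▷ (A ⊗ w.obj) ≫ (λ_ (A ⊗ w.obj)).hom =
      (shuffle A w).hom ≫ (A ⊗ A) ◁ (w.hom ▷ w.obj ≫ (λ_ w.obj).hom) ≫
        (f ▷ A ≫ (λ_ A).hom) ▷ w.obj := by
  have h := w.hom_braid A
  simp only [shuffle, Iso.trans_hom, whiskerLeftIso_hom, whiskerRightIso_hom, Iso.symm_hom]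
  calc _ = 𝟙 _ ⊗≫ A ◁ (w.hom ▷ A ≫ (λ_ A).hom) ▷ w.obj ⊗≫ f ▷ A ▷ w.obj ⊗≫ 𝟙 _ := by
        rw [Stalk.counit]; monoidal
    _ = _ := by rw [← h]; monoidal

lemma whiskerLeft_counit_comp :
    (A ⊗ w.obj) ◁ (Stalk.counit A w ≫ f) ≫ (ρ_ (A ⊗ w.obj)).hom =
      (shuffle A w).hom ≫ (A ⊗ A) ◁ (w.hom ▷ w.obj ≫ (λ_ w.obj).hom) ≫
        (A ◁ f ≫ (ρ_ A).hom) ▷ w.obj := by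
  have h := w.hom_braid' f
  simp only [shuffle, Iso.trans_hom, whiskerLeftIso_hom, whiskerRightIso_hom, Iso.symm_hom]
  rw [w.central]
  calc _ = 𝟙 _ ⊗≫ ((A ⊗ w.obj) ⊗ A) ◁ w.hom ⊗≫ A ◁ (w.obj ◁ f ≫ (ρ_ w.obj).hom) ⊗≫ 𝟙 _ := by
        rw [Stalk.counit]; monoidal
    _ = 𝟙 _ ⊗≫ ((A ⊗ (w.obj ⊗ A)) ◁ w.hom ≫ (A ◁ (w.braid.β A).hom) ▷ 𝟙_ C) ⊗≫
          A ◁ f ▷ w.obj ⊗≫ 𝟙 _ := by rw [← h]; monoidal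
    _ = _ := by rw [whisker_exchange]; monoidal

/-- The central idempotent obtained from a morphism `f : A ⟶ 𝟙_ C` that satisfies the axioms after
restriction to a central idempotent `w`. -/
def ofLocal (hc : (f ▷ A ≫ (λ_ A).hom) ▷ w.obj = (A ◁ f ≫ (ρ_ A).hom) ▷ w.obj)
    (hi : IsIso ((f ▷ A ≫ (λ_ A).hom) ▷ w.obj)) (b : HalfBraiding (A ⊗ w.obj))
    (hb : ∀ B : C, (b.β B).hom ≫ B ◁ (Stalk.counit A w ≫ f) ≫ (ρ_ B).hom =
      (Stalk.counit A w ≫ f) ▷ B ≫ (λ_ B).hom) : CentralIdempotent C where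
  obj := A ⊗ w.obj
  hom := Stalk.counit A w ≫ f
  braid := b
  hom_braid := hb
  central := by rw [counit_comp_whiskerRight, whiskerLeft_counit_comp, hc]
  isIso_left := by
    rw [counit_comp_whiskerRight]
    infer_instance

lemma tensorHom_comp_left {B : C} (u : CentralIdempotent C) (e : B ⟶ u.obj) :
    (e ⊗ₘ e) ≫ u.hom ▷ u.obj ≫ (λ_ u.obj).hom = ((e ≫ u.hom) ▷ B ≫ (λ_ B).hom) ≫ e := by
  rw [tensorHom_def', Category.assoc, ← comp_whiskerRight_assoc, whisker_exchange_assoc,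
    leftUnitor_naturality, Category.assoc]

lemma tensorHom_comp_right {B : C} (u : CentralIdempotent C) (e : B ⟶ u.obj) :
    (e ⊗ₘ e) ≫ u.obj ◁ u.hom ≫ (ρ_ u.obj).hom = (B ◁ (e ≫ u.hom) ≫ (ρ_ B).hom) ≫ e := by
  rw [MonoidalCategory.tensorHom_def, Category.assoc, ← whiskerLeft_comp_assoc,
    ← whisker_exchange_assoc, rightUnitor_naturality, Category.assoc]

lemma central_of_iso {B : C} (u : CentralIdempotent C) (e : B ⟶ u.obj) [IsIso e] :
    (e ≫ u.hom) ▷ B ≫ (λ_ B).hom = B ◁ (e ≫ u.hom) ≫ (ρ_ B).hom := by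
  rw [← cancel_mono e, ← tensorHom_comp_left, ← tensorHom_comp_right, u.central]

lemma isIso_left_of_iso {B : C} (u : CentralIdempotent C) (e : B ⟶ u.obj) [IsIso e] :
    IsIso ((e ≫ u.hom) ▷ B ≫ (λ_ B).hom) := by
  have : IsIso (((e ≫ u.hom) ▷ B ≫ (λ_ B).hom) ≫ e) := by
    rw [← tensorHom_comp_left]
    infer_instance
  exact IsIso.of_isIso_comp_right _ e

end CentralIdempotent

namespace Stalk

open CentralIdempotent

variable {x : Order.PFilter (ZI C)}

lemma exists_mapIdem_toZI_eq [BraidedCategory C] (u : CentralIdempotent (Stalk x)) :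
    ∃ u₀ : CentralIdempotent C, (mapIdem x u₀).toZI = u.toZI := by
  obtain ⟨A, e, (f : A ⟶ 𝟙_ C), _, hf⟩ := exists_fraction u.hom
  have central := u.central_of_iso ((toStalk x).map e)
  have isIso_left := u.isIso_left_of_iso ((toStalk x).map e)
  rw [hf, map_whiskerRight_comp_leftUnitor] at central isIso_left
  rw [whiskerLeft_map_comp_rightUnitor] at central
  obtain ⟨w₁, hw₁, h₁⟩ := map_eq_map_iff.1 central
  obtain ⟨w₂, hw₂, h₂⟩ := isIso_map_iff.1 isIso_left
  let w := w₁.tensor w₂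
  have hb (B : C) : (β_ (A ⊗ w.obj) B).hom ≫ B ◁ (counit A w ≫ f) ≫ (ρ_ B).hom =
      (counit A w ≫ f) ▷ B ≫ (λ_ B).hom := by
    rw [← BraidedCategory.braiding_naturality_left_assoc, braiding_rightUnitor]
  let u₀ : CentralIdempotent C :=
    ofLocal f w (whiskerRight_eq_of_toZI_le (tensorFst w₁ w₂).toZI_le h₁)
      (isIso_whiskerRight_of_toZI_le (tensorSnd w₁ w₂).toZI_le)
      (Center.ofBraidedObj (A ⊗ w.obj)).2 hb
  have := isIso_toStalk_counit A w (tensor_mem hw₁ hw₂)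
  have fac : ((toStalk x).map (counit A w) ≫ (toStalk x).map e) ≫ u.hom =
      (toStalk x).map (counit A w ≫ f) := by
    rw [Category.assoc, hf, map_comp_map]
  let p : (mapIdem x u₀).obj ⟶ u.obj := (toStalk x).map (counit A w) ≫ (toStalk x).map e
  have : IsIso p := inferInstanceAs (IsIso ((toStalk x).map (counit A w) ≫ (toStalk x).map e))
  exact ⟨u₀, toZI_eq_of_isIso p fac⟩

end Stalk

lemma isVeeLocal_stalk [BraidedCategory C] (h : ∀ a b : ZI C, ∃ c, IsLUB {a, b} c)
    (x : PrimeFilter (ZI C)) : IsVeeLocal (Stalk x.filter) := by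
  constructor
  · obtain ⟨a, ha⟩ := x.proper
    obtain ⟨u, rfl⟩ := CentralIdempotent.exists_toZI_eq a
    exact ⟨(Stalk.mapIdem x.filter u).toZI, ⊤, fun hu => ha (Stalk.mapIdem_eq_top_iff.1 hu)⟩
  · intro a b hab
    obtain ⟨p, rfl⟩ := CentralIdempotent.exists_toZI_eq a
    obtain ⟨q, rfl⟩ := CentralIdempotent.exists_toZI_eq b
    obtain ⟨u, hu⟩ := Stalk.exists_mapIdem_toZI_eq p
    obtain ⟨v, hv⟩ := Stalk.exists_mapIdem_toZI_eq q
    obtain ⟨c, hc⟩ := h u.toZI v.toZI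
    obtain ⟨w, rfl⟩ := CentralIdempotent.exists_toZI_eq c
    rw [← hu, ← hv] at hab ⊢
    have htop : (Stalk.mapIdem x.filter w).toZI = ⊤ := by
      refine top_le_iff.1 (hab.2 ?_)
      rintro _ (rfl | rfl)
      · exact Stalk.mapIdem_mono (hc.1 (Set.mem_insert _ _))
      · exact Stalk.mapIdem_mono (hc.1 (Set.mem_insert_of_mem _ rfl))
    rw [Stalk.mapIdem_eq_top_iff, Stalk.mapIdem_eq_top_iff]
    exact x.prime _ _ _ hc (Stalk.mapIdem_eq_top_iff.1 htop)

end Lifting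

section Envelope

/-- A star-preserving endofunctor of `C` with an initial object `star` adjoined, labelled by an
object of `C`. These endofunctors form the `∨`-local monoidal category into which `C` embeds. The
label plays no role in the morphisms; it makes the embedding injective on objects. -/
structure LabelledEndofunctor (C : Type u) [Category.{v} C] : Type (max u v) where
  functor : WithInitial C ⥤ WithInitial C
  obj_star : functor.obj .star = .star
  label : C

namespace LabelledEndofunctor

open Limits

variable {C : Type u} [Category.{v} C]

/-- The morphisms of labelled endofunctors: natural transformations of the functors. -/
@[ext]
structure Hom (F G : LabelledEndofunctor C) : Type (max u v) where
  natTrans : F.functor ⟶ G.functor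

@[simps]
instance : Category.{max u v} (LabelledEndofunctor C) where
  Hom := Hom
  id F := ⟨𝟙 F.functor⟩
  comp φ ψ := ⟨φ.natTrans ≫ ψ.natTrans⟩

variable {F G : LabelledEndofunctor C}

def isInitialObjStar (F : LabelledEndofunctor C) : IsInitial (F.functor.obj .star) :=
  WithInitial.starInitial.ofIso (eqToIso F.obj_star.symm)

/- The component at `star` carries no information, since a labelled endofunctor preserves the
initial object. -/
@[ext]
lemma hom_ext_of {φ ψ : F ⟶ G}
    (h : ∀ X : C, φ.natTrans.app (.of X) = ψ.natTrans.app (.of X)) : φ = ψ := by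
  refine Hom.ext (NatTrans.ext (funext fun X => ?_))
  cases X with
  | star => exact F.isInitialObjStar.hom_ext _ _
  | of X => exact h X

@[simps]
def isoMk (e : F.functor ≅ G.functor) : F ≅ G where
  hom := ⟨e.hom⟩
  inv := ⟨e.inv⟩

lemma isIso_app (φ : F ⟶ G) [IsIso φ] (X : WithInitial C) : IsIso (φ.natTrans.app X) :=
  ⟨(inv φ).natTrans.app X, congrArg (fun ψ => ψ.natTrans.app X) (IsIso.hom_inv_id φ),
    congrArg (fun ψ => ψ.natTrans.app X) (IsIso.inv_hom_id φ)⟩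

lemma isIso_of_isIso_app_of (φ : F ⟶ G) (h : ∀ X : C, IsIso (φ.natTrans.app (.of X))) :
    IsIso φ := by
  have (X : WithInitial C) : IsIso (φ.natTrans.app X) := by
    cases X with
    | star => exact isIso_of_isInitial F.isInitialObjStar G.isInitialObjStar _
    | of X => exact h X
  have : IsIso φ.natTrans := NatIso.isIso_of_isIso_app _
  exact (isoMk (asIso φ.natTrans)).isIso_hom

/-- The unique extension to the adjoined initial object of a natural transformation on the objects
of `C`. -/
def homOfIncl (η : WithInitial.incl ⋙ F.functor ⟶ WithInitial.incl ⋙ G.functor) : F ⟶ G where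
  natTrans :=
    { app := fun
        | .of X => η.app X
        | .star => F.isInitialObjStar.to _
      naturality := fun X Y f => by
        cases X with
        | star => exact F.isInitialObjStar.hom_ext _ _
        | of X =>
          cases Y with
          | star => exact (WithInitial.false_of_to_star f).elim
          | of Y => exact η.naturality f }

def isoOfIncl (e : WithInitial.incl ⋙ F.functor ≅ WithInitial.incl ⋙ G.functor) : F ≅ G where
  hom := homOfIncl e.hom
  inv := homOfIncl e.inv
  hom_inv_id := hom_ext_of fun X => e.hom_inv_id_app X
  inv_hom_id := hom_ext_of fun X => e.inv_hom_id_app X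

def isInitialOfObj (h : ∀ X, F.functor.obj X = .star) : IsInitial F :=
  have hF (X : WithInitial C) : IsInitial (F.functor.obj X) :=
    WithInitial.starInitial.ofIso (eqToIso (h X).symm)
  .ofUniqueHom
    (fun _ => ⟨{ app X := (hF X).to _, naturality X _ _ := (hF X).hom_ext _ _ }⟩)
    (fun _ _ => hom_ext_of fun X => (hF (.of X)).hom_ext _ _)

variable [MonoidalCategory C]

@[simps]
instance : MonoidalCategoryStruct (LabelledEndofunctor C) where
  tensorObj F G :=
    ⟨F.functor ⋙ G.functor, by rw [Functor.comp_obj, F.obj_star, G.obj_star], F.label ⊗ G.label⟩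
  whiskerLeft F _ _ φ := ⟨Functor.whiskerLeft F.functor φ.natTrans⟩
  whiskerRight φ F := ⟨Functor.whiskerRight φ.natTrans F.functor⟩
  tensorHom φ ψ := ⟨φ.natTrans ◫ ψ.natTrans⟩
  tensorUnit := ⟨𝟭 _, rfl, 𝟙_ C⟩
  associator F G H := isoMk (Functor.associator F.functor G.functor H.functor)
  leftUnitor F := isoMk F.functor.leftUnitor
  rightUnitor F := isoMk F.functor.rightUnitor

instance : MonoidalCategory (LabelledEndofunctor C) where

/-- The endofunctor that is constant with value the adjoined initial object. -/
abbrev zero : LabelledEndofunctor C := ⟨(Functor.const _).obj .star, rfl, 𝟙_ C⟩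

variable (C) in
/-- The central idempotent with initial domain. -/
def zeroIdem : CentralIdempotent (LabelledEndofunctor C) :=
  .ofIsInitial (Z := zero) (fun _ => isInitialOfObj fun _ => rfl)
    (fun F => isInitialOfObj fun _ => F.obj_star)

lemma toZI_zeroIdem_ne_top : (zeroIdem C).toZI ≠ ⊤ := fun h => by
  have := CentralIdempotent.toZI_eq_top_iff_isIso_hom.1 h
  exact WithInitial.false_of_to_star ((inv (zeroIdem C).hom).natTrans.app (.of (𝟙_ C)))

/-- The endofunctor that is constant with value `X` on the objects of `C`. -/
abbrev const (X : C) : LabelledEndofunctor C :=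
  ⟨WithInitial.map ((Functor.const C).obj X), rfl, 𝟙_ C⟩

lemma isIso_const_map (X : C) {Y Z : WithInitial C} (f : Y ⟶ Z) (hY : Y ≠ .star) :
    IsIso ((const X).functor.map f) := by
  cases Y with
  | star => exact absurd rfl hY
  | of Y =>
    cases Z with
    | star => exact (WithInitial.false_of_to_star f).elim
    | of Z => exact inferInstanceAs (IsIso (𝟙 (WithInitial.of X)))

lemma braid_app_comp_hom_app (u : CentralIdempotent (LabelledEndofunctor C)) (X B : C) :
    (u.braid.β (const X)).hom.natTrans.app (.of B) ≫ u.hom.natTrans.app (.of X) =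
      (const X).functor.map (u.hom.natTrans.app (.of B)) := by
  have h := congrArg (fun φ => φ.natTrans.app (.of B)) (u.hom_braid (const X))
  change (u.braid.β (const X)).hom.natTrans.app (.of B) ≫ u.hom.natTrans.app (.of X) ≫ 𝟙 _ =
    (const X).functor.map (u.hom.natTrans.app (.of B)) ≫ 𝟙 _ at h
  exact (congrArg (_ ≫ ·) (Category.comp_id _).symm).trans (h.trans (Category.comp_id _))

lemma isIso_hom_of_obj_ne_star (u : CentralIdempotent (LabelledEndofunctor C)) {B : C}
    (hB : u.obj.functor.obj (.of B) ≠ .star) : IsIso u.hom := by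
  refine isIso_of_isIso_app_of _ fun X => ?_
  have : IsIso ((u.braid.β (const X)).hom.natTrans.app (.of B) ≫
      u.hom.natTrans.app (.of X)) := by
    rw [braid_app_comp_hom_app]
    exact isIso_const_map X _ hB
  have := isIso_app (u.braid.β (const X)).hom (.of B)
  exact IsIso.of_isIso_comp_left ((u.braid.β (const X)).hom.natTrans.app (.of B)) _

lemma toZI_eq_top_or_le (a : ZI (LabelledEndofunctor C)) : a = ⊤ ∨ a ≤ (zeroIdem C).toZI := by
  obtain ⟨u, rfl⟩ := CentralIdempotent.exists_toZI_eq a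
  rw [CentralIdempotent.toZI_eq_top_iff_isIso_hom, or_iff_not_imp_left]
  intro hu
  have obj_of (B : C) : u.obj.functor.obj (.of B) = .star := by
    by_contra hB
    exact hu (isIso_hom_of_obj_ne_star u hB)
  refine CentralIdempotent.isBot_toZI_of_isInitial (isInitialOfObj fun X => ?_) _
  cases X with
  | star => exact u.obj.obj_star
  | of B => exact obj_of B

lemma isVeeLocal : IsVeeLocal (LabelledEndofunctor C) :=
  .of_eq_top_or_le toZI_zeroIdem_ne_top toZI_eq_top_or_le

variable (C) in
/-- The right action of `C` on itself by tensoring. -/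
abbrev tensoring : C ⥤ LabelledEndofunctor C where
  obj A := ⟨WithInitial.map ((tensoringRight C).obj A), rfl, A⟩
  map f := ⟨WithInitial.map₂ ((tensoringRight C).map f)⟩
  map_id A := by ext X; exact whiskerLeft_id X A
  map_comp f g := by ext X; exact whiskerLeft_comp X f g

instance : (tensoring C).Faithful where
  map_injective {A B f g} h := by
    have h' : 𝟙_ C ◁ f = 𝟙_ C ◁ g := congrArg (fun φ => φ.natTrans.app (.of (𝟙_ C))) h
    exact (whiskerLeft_iff f g).1 h'

lemma tensoring_obj_injective : Function.Injective (tensoring C).obj :=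
  fun _ _ h => congrArg label h

/-- The unit of the right action, on the objects of `C` the right unitors. -/
def tensoringUnitIso : 𝟙_ (LabelledEndofunctor C) ≅ (tensoring C).obj (𝟙_ C) :=
  isoOfIncl (NatIso.ofComponents (fun X => WithInitial.incl.mapIso (ρ_ X).symm)
    fun f => rightUnitor_inv_naturality f)

/-- The multiplication of the right action, on the objects of `C` the associators. -/
def tensoringTensorIso (A B : C) :
    (tensoring C).obj A ⊗ (tensoring C).obj B ≅ (tensoring C).obj (A ⊗ B) :=
  isoOfIncl (NatIso.ofComponents (fun X => WithInitial.incl.mapIso (α_ X A B))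
    fun f => associator_naturality_left f A B)

instance : (tensoring C).Monoidal :=
  Functor.CoreMonoidal.toMonoidal
    { εIso := tensoringUnitIso
      μIso := tensoringTensorIso
      μIso_hom_natural_left f Z := by
        ext X
        exact associator_naturality_middle X f Z
      μIso_hom_natural_right Z f := by
        ext X
        exact associator_naturality_right X Z f
      associativity X Y Z := by
        ext W
        have h : (α_ W X Y).hom ▷ Z ≫ (α_ W (X ⊗ Y) Z).hom ≫ W ◁ (α_ X Y Z).hom =
            𝟙 _ ≫ (α_ (W ⊗ X) Y Z).hom ≫ (α_ W X (Y ⊗ Z)).hom := by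
          rw [pentagon, Category.id_comp]
        exact h
      left_unitality X := by
        ext W
        have h : 𝟙 (W ⊗ X) = (ρ_ W).inv ▷ X ≫ (α_ W (𝟙_ C) X).hom ≫ W ◁ (λ_ X).hom := by
          rw [triangle, inv_hom_whiskerRight]
        exact h
      right_unitality X := by
        ext W
        have h : 𝟙 (W ⊗ X) =
            (ρ_ (W ⊗ X)).inv ≫ (α_ W X (𝟙_ C)).hom ≫ W ◁ (ρ_ X).hom := by
          rw [whiskerLeft_rightUnitor, Iso.hom_inv_id_assoc, Iso.inv_hom_id]
        exact h }

end LabelledEndofunctor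

lemma exists_embedding_isVeeLocal (C : Type u) [Category.{v} C] [MonoidalCategory C] :
    ∃ (ι : Type (max u v)) (D : ι → Type (max u v)) (_ : ∀ i, Category.{max u v} (D i))
      (_ : ∀ i, MonoidalCategory (D i)) (F : C ⥤ (∀ i, D i)),
      (∀ i, IsVeeLocal (D i)) ∧ Nonempty F.Monoidal ∧ F.Faithful ∧ Function.Injective F.obj :=
  ⟨PUnit, fun _ => LabelledEndofunctor C, fun _ => inferInstance, fun _ => inferInstance,
    Functor.pi' fun _ => LabelledEndofunctor.tensoring C,
    fun _ => LabelledEndofunctor.isVeeLocal, ⟨inferInstance⟩,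
    ⟨fun h => (LabelledEndofunctor.tensoring C).map_injective (congrFun h PUnit.unit)⟩,
    fun _ _ h => LabelledEndofunctor.tensoring_obj_injective (congrFun h PUnit.unit)⟩

end Envelope

theorem mainTheorem6 (C : Type u) [Category.{v} C] [MonoidalCategory C]
    (hC : HasUniversalFiniteJoins C) :
    (Nonempty (toStalks C).Monoidal ∧ (toStalks C).Faithful ∧
      (Nontrivial (ZI C) → Function.Injective (toStalks C).obj)) ∧
    (BraidedCategory C → ∀ x : PrimeFilter (ZI C), IsVeeLocal (Stalk x.filter)) ∧
    (∃ (ι : Type (max u v)) (D : ι → Type (max u v)) (_ : ∀ i, Category.{max u v} (D i))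
      (_ : ∀ i, MonoidalCategory (D i)) (F : C ⥤ (∀ i, D i)),
      (∀ i, IsVeeLocal (D i)) ∧ Nonempty F.Monoidal ∧ F.Faithful ∧
        Function.Injective F.obj) := by
  refine ⟨⟨⟨inferInstance⟩, hC.faithful_toStalks, fun _ => ?_⟩,
    fun _ x => isVeeLocal_stalk hC.exists_isLUB x, exists_embedding_isVeeLocal C⟩
  have := hC.nonempty_primeFilter
  exact toStalks_obj_injective
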